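/- **Setting.** Let $d\ge 1$, let $\|x\|=\max_i|x_i|$ on $\mathbb Z^d$, and let $H_\omega=\varepsilon\Gamma_\phi+V_\omega(x)\delta_{x,y}$ on $\ell^2(\mathbb Z^d)$, $\varepsilon>0$. Here $\Gamma_\phi(x,y)=\phi(x-y)=\overline{\phi(y-x)}$ with $|\phi(x)|\le e^{-\gamma\log^{\rho}(\|x\|+1)}$ for some $\gamma>0$, $\rho>1$, and $\{V_\omega(x)\}_{x\in\mathbb Z^d}$ are i.i.d. random variables on a probability space $(\Omega,\mathcal F,\mathbb P)$ whose common distribution $\mu$ satisfies $\operatorname{supp}\mu\subset[-M,M]$, $M>0$. Write $\|\Gamma_\phi\|$ for the operator norm on $\ell^2(\mathbb Z^d)$, $[\,\cdot\,]$ for the integer part, and $$\frac1{\mathcal D_\lambda(\mu)}:=\inf_{t>0}\ \sup_{0<|b-a|\le t}\mu([a,b])\,|b-a|^{-\lambda}\in[0,\infty];$$ $\mu$ is Hölder continuous of order $\lambda>0$ if this quantity is finite. For $L>0$ let $B_L(x)=\{y\in\mathbb Z^d:\|y-x\|\le L\}$, let $H_{B}$ be the restriction of $H_\omega$ to $\ell^2(B)$,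 and let $G_B^E=(H_B-E)^{-1}$. Fix $\rho'\in(1,\rho)$. The cube $B_L(x)$ is *$(\kappa,E)$-good* if $\operatorname{dist}(E,\sigma(H_{B_L(x)}))\ge e^{-\log^{\rho'}L}$ and $|G^E_{B_L(x)}(x,y)|\le e^{-\kappa\log^\rho(\|x-y\|+1)}$ for all $y\in B_L(x)$ with $\|y-x\|>L^{4/5}$; otherwise it is *$(\kappa,E)$-bad*. Fix also $\kappa_0\in(0,\gamma/5]$, $\kappa_\infty\in(0,\kappa_0)$, $p>5d$ and $\alpha\in\left(\frac54,\frac{2p}{p+2d}\right)$. **Theorem 5.4 (MSA).** Let $\mu$ be Hölder continuous of order $\lambda>0$ and let $0<\beta<\mathcal D_\lambda(\mu)$. There exists $\underline L_0=\underline L_0(M,\phi,\beta,\mu,\lambda,p,d,\gamma,\rho,\rho',\alpha,\kappa_0,\kappa_\infty)>0$ such that for every $L_0\ge\underline L_0$ there are $\varepsilon_0=\varepsilon_0(\beta,\mu,L_0,d,\lambda,\phi)>0$ and $\eta=\eta(\beta,L_0,d,\lambda)>0$, all depending only on the listed quantities, with the following property. For every $E_0\in\mathbb R$ with $|E_0|\le2(\|\Gamma_\phi\|+M)$,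 all $0<\varepsilon<\varepsilon_0$, all $s\ge0$, and all $x,y\in\mathbb Z^d$ with $\|x-y\|>2L_s$, $$\mathbb P\{\exists E\in[E_0-\eta,E_0+\eta]\ \text{such that both } B_{L_s}(x)\text{ and }B_{L_s}(y)\text{ are } (\kappa_\infty,E)\text{-bad}\}\le L_s^{-2p},$$ where $L_{s+1}=[L_s^\alpha]$. -/

import Mathlib

open MeasureTheory ProbabilityTheory
open scoped ENNReal

noncomputable section

namespace LongRangeMSA

/-- The lattice `ℤ^d`; its norm is the sup norm `‖x‖ = max |x i|`. -/
abbrev Lattice (d : ℕ) : Type := Fin d → ℤ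

/-- `ℓ²(ℤ^d)`. -/
abbrev l2 (d : ℕ) : Type := lp (fun _ : Lattice d => ℂ) 2

theorem memlp_shift {d : ℕ} (k : Lattice d) (f : l2 d) :
    Memℓp (fun x : Lattice d => f (x - k)) 2 := by
  have h2 : (0 : ℝ) < (2 : ℝ≥0∞).toReal := by norm_num
  have h := (memℓp_gen_iff h2).1 (lp.memℓp f)
  exact (memℓp_gen_iff h2).2 ((Equiv.subRight k).summable_iff.2 h)

/-- The translation `(T_k f)(x) = f (x - k)` on `ℓ²(ℤ^d)`. -/
def shift {d : ℕ} (k : Lattice d) : l2 d →ₗᵢ[ℂ] l2 d where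
  toFun f := ⟨fun x => f (x - k), memlp_shift k f⟩
  map_add' _ _ := rfl
  map_smul' _ _ := rfl
  norm_map' f := by
    have h2 : (0 : ℝ) < (2 : ℝ≥0∞).toReal := by norm_num
    rw [lp.norm_eq_tsum_rpow h2, lp.norm_eq_tsum_rpow h2]
    congr 1
    exact (Equiv.subRight k).tsum_eq (fun x => ‖f x‖ ^ (2 : ℝ≥0∞).toReal)

/-- The translation invariant operator `Γ_φ = ∑ₖ φ(k) T_k` on `ℓ²(ℤ^d)`, for summable `φ`; its
matrix is `Γ_φ(x, y) = φ(x - y)`, see `hoppingOp_apply`. Its norm `‖hoppingOp φ‖` is the operator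
norm on `ℓ²(ℤ^d)`. -/
def hoppingOp {d : ℕ} (φ : Lattice d → ℂ) : l2 d →L[ℂ] l2 d :=
  ∑' k, φ k • (shift k).toContinuousLinearMap

theorem hoppingOp_apply {d : ℕ} (φ : Lattice d → ℂ) (hφ : Summable fun k => ‖φ k‖)
    (f : l2 d) (x : Lattice d) : hoppingOp φ f x = ∑' y, φ (x - y) * f y := by
  have hs : Summable fun k => φ k • (shift k).toContinuousLinearMap := by
    refine Summable.of_norm_bounded hφ fun k => ?_
    rw [norm_smul]
    exact mul_le_of_le_one_right (norm_nonneg _) (shift k).norm_toContinuousLinearMap_le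
  have h1 := (ContinuousLinearMap.apply ℂ (l2 d) f).hasSum hs.hasSum
  have h2 := (lp.evalCLM ℂ (fun _ : Lattice d => ℂ) (2 : ℝ≥0∞) x).hasSum h1
  have h3 : HasSum (fun k => φ k * f (x - k)) (hoppingOp φ f x) := h2
  rw [← h3.tsum_eq, ← (Equiv.subLeft x).tsum_eq]
  simp

/-- The matrix of `H = ε Γ_φ + v(x) δ_{x,y}` in the standard basis of `ℓ²(ℤ^d)`. -/
def hamiltonian {d : ℕ} (ε : ℝ) (φ : Lattice d → ℂ) (v : Lattice d → ℝ) :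
    Matrix (Lattice d) (Lattice d) ℂ :=
  Matrix.of fun x y => (ε : ℂ) * φ (x - y) + if x = y then (v x : ℂ) else 0

theorem finite_cube {d : ℕ} (x : Lattice d) (L : ℝ) : {y : Lattice d | ‖y - x‖ ≤ L}.Finite := by
  have h : {y : Lattice d | ‖y - x‖ ≤ L} = Metric.closedBall x L := by
    ext y; simp [dist_eq_norm]
  rw [h]
  exact (isCompact_closedBall x L).finite_of_discrete

/-- The cube `B_L(x) = {y ∈ ℤ^d : ‖y - x‖ ≤ L}`. -/
def cube {d : ℕ} (x : Lattice d) (L : ℝ) : Finset (Lattice d) := (finite_cube x L).toFinset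

theorem mem_cube {d : ℕ} {x y : Lattice d} {L : ℝ} : y ∈ cube x L ↔ ‖y - x‖ ≤ L := by
  simp [cube]

/-- The restriction `H_B` of `H` to a finite set `B`, an operator on `ℓ²(B)`. -/
def restrict {d : ℕ} (H : Matrix (Lattice d) (Lattice d) ℂ) (B : Finset (Lattice d)) :
    Matrix B B ℂ :=
  H.submatrix Subtype.val Subtype.val

/-- The Green's function `G_B^E = (H_B - E)⁻¹` (meaningful for `E ∉ σ(H_B)`). -/
def green {d : ℕ} (H : Matrix (Lattice d) (Lattice d) ℂ) (B : Finset (Lattice d)) (E : ℝ) :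
    Matrix B B ℂ :=
  (restrict H B - (E : ℂ) • (1 : Matrix B B ℂ))⁻¹

/-- `B_L(x)` is non-resonant at `E`: `dist(E, σ(H_{B_L(x)})) ≥ exp(-log^{ρ'} L)`. -/
def NonResonant {d : ℕ} (H : Matrix (Lattice d) (Lattice d) ℂ) (ρ' E : ℝ) (x : Lattice d)
    (L : ℝ) : Prop :=
  Real.exp (-(Real.log L) ^ ρ') ≤
    Metric.infDist (E : ℂ) (spectrum ℂ (restrict H (cube x L)))

/-- `B_L(x)` is `(κ, E)`-good: it is non-resonant at `E` and
`|G^E(x, y)| ≤ exp(-κ log^ρ(‖x - y‖ + 1))` for `y ∈ B_L(x)` with `‖y - x‖ > L^{4/5}`. -/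
def Good {d : ℕ} (H : Matrix (Lattice d) (Lattice d) ℂ) (ρ ρ' κ E : ℝ) (x : Lattice d)
    (L : ℝ) : Prop :=
  NonResonant H ρ' E x L ∧
    ∀ (hx : x ∈ cube x L) (y : Lattice d) (hy : y ∈ cube x L), L ^ (4 / 5 : ℝ) < ‖y - x‖ →
      ‖green H (cube x L) E ⟨x, hx⟩ ⟨y, hy⟩‖ ≤
        Real.exp (-κ * (Real.log (‖x - y‖ + 1)) ^ ρ)

/-- `(κ, E)`-bad means not `(κ, E)`-good. -/
def Bad {d : ℕ} (H : Matrix (Lattice d) (Lattice d) ℂ) (ρ ρ' κ E : ℝ) (x : Lattice d)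
    (L : ℝ) : Prop :=
  ¬ Good H ρ ρ' κ E x L

/-- `inf_{t > 0} sup_{0 < |b - a| ≤ t} μ([a, b]) |b - a|^{-lam}`, with values in `[0, ∞]`. -/
def holderCoeff (lam : ℝ) (μ : Measure ℝ) : ℝ≥0∞ :=
  ⨅ (t : ℝ) (_ : 0 < t), ⨆ (a : ℝ) (b : ℝ) (_ : 0 < |b - a| ∧ |b - a| ≤ t),
    μ (Set.Icc a b) * ENNReal.ofReal (|b - a| ^ (-lam))

/-- `μ` is Hölder continuous of order `lam`. -/
def IsHolder (lam : ℝ) (μ : Measure ℝ) : Prop := holderCoeff lam μ < ∞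

/-- `D_lam(μ) ∈ [0, ∞]`, the inverse of `holderCoeff`; it is positive iff `IsHolder lam μ`. -/
def holderD (lam : ℝ) (μ : Measure ℝ) : ℝ≥0∞ := (holderCoeff lam μ)⁻¹

/-- The scales `L_{s+1} = [L_s^α]`. -/
def scale (α L₀ : ℝ) : ℕ → ℝ
  | 0 => L₀
  | s + 1 => (⌊scale α L₀ s ^ α⌋ : ℤ)

end LongRangeMSA

end

open LongRangeMSA

/-!
Bad cubes at the scale `L ≈ l ^ α` have only two causes. Suppose that a cube of radius `L` has no
resonant subregion in a suitable finite family and does not contain four bad cubes of radius `l`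
with centres at mutual distances larger than `2 l`. Given a point `w`, one of any four disjoint
annuli of width `l` around `w` is free of bad centres. By the geometric resolvent identity on the
cube inside that annulus one leaves it either by a long jump, which gains the decay of the hopping
term, or by a short one to the centre of a good cube, whose Green's function gives decay over the
next hop. To get from `x` to `y` by such hops takes either one long hop or many short ones, so the
Green's function decays at a rate only slightly smaller than before.

For two disjoint cubes, resonance of both at a common energy is a Wegner estimate: the energy is
within the gap threshold of one of the finitely many eigenvalues of the second region, and
resampling the potential at a site where an approximate eigenvector of the first region has at least
average mass shows that the probability is controlled by the modulus of continuity of `μ`. As the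
threshold `exp (-log^ρ' L)` is superpolynomially small, so is this probability. If both cubes are
bad and one is not resonant, it contains four separated bad cubes, hence two independent bad pairs:
these cost `l ^ (-4 p) ≤ L ^ (-4 p / α)`, which beats the `L ^ (4 d)` choices of centres precisely
because `α (p + 2 d) < 2 p`.

At the initial scale `ε ≤ exp (-L₀)` makes the Hamiltonian almost diagonal, so that a cube can only
be bad if the potential is close to `E₀` at one of its sites.
-/

namespace LongRangeMSA

open Matrix Filter Topology

/-! ### Lower bounds for matrices -/

section Matrix

theorem isHermitian_sub_smul_one {n : Type*} [DecidableEq n] {A : Matrix n n ℂ}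
    (hA : A.IsHermitian) (E : ℝ) : (A - (E : ℂ) • (1 : Matrix n n ℂ)).IsHermitian :=
  hA.sub (by simp [IsHermitian, conjTranspose_smul])

theorem exists_inv_card_le_sq_norm {n : Type*} [Fintype n] {ψ : EuclideanSpace ℂ n}
    (hψ : ‖ψ‖ = 1) : ∃ i, (Fintype.card n : ℝ)⁻¹ ≤ ‖ψ i‖ ^ 2 := by
  have hsum : ∑ i, ‖ψ i‖ ^ 2 = 1 := by rw [← EuclideanSpace.norm_sq_eq, hψ, one_pow]
  have hne : Nonempty n := by
    by_contra! h
    simp at hsum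
  obtain ⟨i, -, hi⟩ := Finset.exists_le_of_sum_le (s := Finset.univ)
    (f := fun _ => (Fintype.card n : ℝ)⁻¹) Finset.univ_nonempty
    (by simp [hsum] : ∑ _ : n, (Fintype.card n : ℝ)⁻¹ ≤ ∑ i, ‖ψ i‖ ^ 2)
  exact ⟨i, hi⟩

variable {n : Type*} [Fintype n] [DecidableEq n] {A : Matrix n n ℂ} {δ η E : ℝ} {i : n}

/-- `‖A ψ‖ ≥ δ ‖ψ‖` in the Euclidean norm. For `A = H - E` with `H` Hermitian this says
`dist (E, σ(H)) ≥ δ`, but it does so as a closed condition on the matrix. -/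
def BoundedBelow (A : Matrix n n ℂ) (δ : ℝ) : Prop :=
  ∀ ψ : EuclideanSpace ℂ n, δ * ‖ψ‖ ≤ ‖toEuclideanLin A ψ‖

/-- `A` has a unit vector in its approximate kernel with at least the average mass at `i`. -/
def ApproxKernelAt (A : Matrix n n ℂ) (η : ℝ) (i : n) : Prop :=
  ∃ ψ : EuclideanSpace ℂ n,
    ‖ψ‖ = 1 ∧ (Fintype.card n : ℝ)⁻¹ ≤ ‖ψ i‖ ^ 2 ∧ ‖toEuclideanLin A ψ‖ < η

theorem toEuclideanLin_sub_smul_one (A : Matrix n n ℂ) (z : ℂ) (ψ : EuclideanSpace ℂ n) :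
    toEuclideanLin (A - z • (1 : Matrix n n ℂ)) ψ = toEuclideanLin A ψ - z • ψ := by
  ext i
  simp [toLpLin_apply]

theorem continuous_norm_toEuclideanLin (ψ : EuclideanSpace ℂ n) :
    Continuous fun A : Matrix n n ℂ => ‖toEuclideanLin A ψ‖ := by
  simp only [toLpLin_apply]
  exact ((PiLp.continuous_toLp 2 _).comp (continuous_id.matrix_mulVec continuous_const)).norm

theorem isClosed_setOf_boundedBelow (δ : ℝ) : IsClosed {A : Matrix n n ℂ | BoundedBelow A δ} := by
  simp only [BoundedBelow, Set.ofPred_forall]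
  exact isClosed_iInter fun ψ => isClosed_le continuous_const (continuous_norm_toEuclideanLin ψ)

theorem isOpen_setOf_approxKernelAt (η : ℝ) (i : n) :
    IsOpen {A : Matrix n n ℂ | ApproxKernelAt A η i} := by
  simp only [ApproxKernelAt, Set.ofPred_exists, Set.ofPred_and]
  exact isOpen_iUnion fun ψ => isOpen_const.inter
    (isOpen_const.inter (isOpen_lt (continuous_norm_toEuclideanLin ψ) continuous_const))

theorem BoundedBelow.mono {δ' : ℝ} (h : BoundedBelow A δ) (hδ : δ' ≤ δ) : BoundedBelow A δ' :=
  fun ψ => (mul_le_mul_of_nonneg_right hδ (norm_nonneg ψ)).trans (h ψ)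

theorem BoundedBelow.isUnit_det (h : BoundedBelow A δ) (hδ : 0 < δ) : IsUnit A.det := by
  rw [isUnit_iff_ne_zero]
  intro h0
  obtain ⟨v, hv, hv0⟩ := exists_mulVec_eq_zero_iff.2 h0
  have hle : δ * ‖WithLp.toLp 2 v‖ ≤ 0 := by
    simpa only [toLpLin_toLp, toLin'_apply, hv0, WithLp.toLp_zero, norm_zero]
      using h (WithLp.toLp 2 v)
  have hzero : ‖WithLp.toLp 2 v‖ ≤ 0 := nonpos_of_mul_nonpos_right hle hδ
  exact hv (by simpa using norm_le_zero_iff.1 hzero)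

theorem BoundedBelow.norm_inv_apply_le (h : BoundedBelow A δ) (hδ : 0 < δ) (u v : n) :
    ‖A⁻¹ u v‖ ≤ δ⁻¹ := by
  set χ : EuclideanSpace ℂ n := WithLp.toLp 2 (A⁻¹.col v)
  have hAχ : toEuclideanLin A χ = WithLp.toLp 2 (Pi.single v 1) := by
    rw [toLpLin_toLp, toLin'_apply, ← mulVec_single_one, mulVec_mulVec,
      mul_nonsing_inv _ (h.isUnit_det hδ), one_mulVec]
  have hχ : δ * ‖χ‖ ≤ 1 := by simpa [hAχ] using h χ
  refine (le_inv_mul_iff₀ hδ).2 ?_ |>.trans_eq (mul_one _)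
  exact (mul_le_mul_of_nonneg_left (PiLp.norm_apply_le χ u) hδ.le).trans hχ

theorem toEuclideanLin_eigenvectorBasis (hA : A.IsHermitian) (k : n) :
    toEuclideanLin A (hA.eigenvectorBasis k) = (hA.eigenvalues k : ℂ) • hA.eigenvectorBasis k := by
  ext i
  simpa [toLpLin_apply] using congrFun (hA.mulVec_eigenvectorBasis k) i

theorem inner_toEuclideanLin (hA : A.IsHermitian) (ψ χ : EuclideanSpace ℂ n) :
    inner ℂ (toEuclideanLin A ψ) χ = inner ℂ ψ (toEuclideanLin A χ) :=
  isSymmetric_toEuclideanLin_iff.mpr hA ψ χ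

theorem boundedBelow_sub_of_eigenvalues (hA : A.IsHermitian) (hδ : 0 ≤ δ)
    (h : ∀ k, δ ≤ |hA.eigenvalues k - E|) :
    BoundedBelow (A - (E : ℂ) • (1 : Matrix n n ℂ)) δ := by
  intro ψ
  have hcoord : ∀ k, inner ℂ (hA.eigenvectorBasis k)
      (toEuclideanLin (A - (E : ℂ) • (1 : Matrix n n ℂ)) ψ) =
      ((hA.eigenvalues k - E : ℝ) : ℂ) * inner ℂ (hA.eigenvectorBasis k) ψ := by
    intro k
    rw [toEuclideanLin_sub_smul_one, inner_sub_right, ← inner_toEuclideanLin hA,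
      toEuclideanLin_eigenvectorBasis, inner_smul_left, inner_smul_right]
    simp [sub_mul]
  refine le_of_sq_le_sq ?_ (norm_nonneg _)
  rw [mul_pow, ← hA.eigenvectorBasis.sum_sq_norm_inner_right ψ,
    ← hA.eigenvectorBasis.sum_sq_norm_inner_right (toEuclideanLin _ ψ), Finset.mul_sum]
  refine Finset.sum_le_sum fun k _ => ?_
  rw [hcoord, norm_mul, mul_pow, Complex.norm_real, Real.norm_eq_abs]
  gcongr
  exact h k

theorem BoundedBelow.le_dist_of_mem_spectrum
    (h : BoundedBelow (A - (E : ℂ) • (1 : Matrix n n ℂ)) δ) {z : ℂ} (hz : z ∈ spectrum ℂ A) :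
    δ ≤ dist (E : ℂ) z := by
  rw [← spectrum_toLpLin 2, ← Module.End.hasEigenvalue_iff_mem_spectrum] at hz
  obtain ⟨ψ, hψ⟩ := hz.exists_hasEigenvector
  have h1 := h ψ
  rw [toEuclideanLin_sub_smul_one, hψ.apply_eq_smul, ← sub_smul, norm_smul] at h1
  rw [dist_comm, dist_eq_norm]
  exact le_of_mul_le_mul_right h1 (norm_pos_iff.2 hψ.2)

theorem le_infDist_spectrum_iff [Nonempty n] (hA : A.IsHermitian) (hδ : 0 ≤ δ) :
    δ ≤ Metric.infDist (E : ℂ) (spectrum ℂ A) ↔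
      BoundedBelow (A - (E : ℂ) • (1 : Matrix n n ℂ)) δ := by
  rw [Metric.le_infDist (spectrum.nonempty_of_isAlgClosed_of_finiteDimensional ℂ A)]
  refine ⟨fun h => boundedBelow_sub_of_eigenvalues hA hδ fun k => ?_,
    fun h z hz => h.le_dist_of_mem_spectrum hz⟩
  have hk := h ((spectrum.algebraMap_mem_iff ℂ).2 (hA.eigenvalues_mem_spectrum_real k))
  rwa [dist_comm, Complex.coe_algebraMap, Complex.dist_eq, ← Complex.ofReal_sub,
    Complex.norm_real, Real.norm_eq_abs] at hk

theorem boundedBelow_of_diagonally_dominant (hA : A.IsHermitian) (hδ : 0 ≤ δ)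
    (h : ∀ i, δ + ∑ j ∈ Finset.univ.erase i, ‖A i j‖ ≤ ‖A i i‖) : BoundedBelow A δ := by
  suffices hE : BoundedBelow (A - ((0 : ℝ) : ℂ) • (1 : Matrix n n ℂ)) δ by simpa using hE
  refine boundedBelow_sub_of_eigenvalues hA hδ fun k => ?_
  have hk : Module.End.HasEigenvalue (toLin' A) (hA.eigenvalues k : ℂ) := by
    rw [Module.End.hasEigenvalue_iff_mem_spectrum, spectrum_toLin']
    exact (spectrum.algebraMap_mem_iff ℂ).2 (hA.eigenvalues_mem_spectrum_real k)
  obtain ⟨j, hj⟩ := eigenvalue_mem_ball hk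
  rw [Metric.mem_closedBall, dist_comm, dist_eq_norm] at hj
  have htri := norm_sub_norm_le (A j j) (hA.eigenvalues k)
  rw [Complex.norm_real, Real.norm_eq_abs] at htri
  rw [sub_zero]
  linarith [h j]

theorem exists_approxKernelAt (h : ¬ BoundedBelow A δ) : ∃ i, ApproxKernelAt A δ i := by
  simp only [BoundedBelow, not_forall, not_le] at h
  obtain ⟨χ, hχ⟩ := h
  have hχ0 : χ ≠ 0 := by
    rintro rfl
    simp at hχ
  set ψ : EuclideanSpace ℂ n := ((‖χ‖⁻¹ : ℝ) : ℂ) • χ with hψdef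
  have hnorm : ‖((‖χ‖⁻¹ : ℝ) : ℂ)‖ = ‖χ‖⁻¹ := by simp
  have hψ : ‖ψ‖ = 1 := by
    rw [hψdef, norm_smul, hnorm, inv_mul_cancel₀ (norm_ne_zero_iff.2 hχ0)]
  obtain ⟨i, hi⟩ := exists_inv_card_le_sq_norm hψ
  refine ⟨i, ψ, hψ, hi, ?_⟩
  rw [hψdef, map_smul, norm_smul, hnorm, inv_mul_lt_iff₀ (norm_pos_iff.2 hχ0), mul_comm]
  exact hχ

theorem ApproxKernelAt.shift_energy {e : ℝ}
    (h : ApproxKernelAt (A - (E : ℂ) • (1 : Matrix n n ℂ)) δ i) (he : |e - E| ≤ δ) :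
    ApproxKernelAt (A - (e : ℂ) • (1 : Matrix n n ℂ)) (2 * δ) i := by
  obtain ⟨ψ, hψ, hi, hE⟩ := h
  refine ⟨ψ, hψ, hi, ?_⟩
  calc ‖toEuclideanLin (A - (e : ℂ) • (1 : Matrix n n ℂ)) ψ‖
      = ‖toEuclideanLin (A - (E : ℂ) • (1 : Matrix n n ℂ)) ψ - ((e - E : ℝ) : ℂ) • ψ‖ := by
        rw [toEuclideanLin_sub_smul_one, toEuclideanLin_sub_smul_one, Complex.ofReal_sub, sub_smul]
        congr 1
        abel
    _ ≤ ‖toEuclideanLin (A - (E : ℂ) • (1 : Matrix n n ℂ)) ψ‖ + |e - E| := by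
        refine (norm_sub_le _ _).trans_eq ?_
        rw [norm_smul, hψ, mul_one, Complex.norm_real, Real.norm_eq_abs]
    _ < 2 * δ := by linarith

theorem abs_le_of_approxKernelAt {A' : Matrix n n ℂ} {t : ℝ} (hA' : A'.IsHermitian)
    (hAA' : A - A' = Matrix.single i i (t : ℂ)) (h : ApproxKernelAt A η i)
    (h' : ApproxKernelAt A' η i) : |t| ≤ 2 * η * Fintype.card n := by
  obtain ⟨ψ, hψ, hi, hη⟩ := h
  obtain ⟨ψ', hψ', hi', hη'⟩ := h'
  have hA : toEuclideanLin A ψ - toEuclideanLin A' ψ = EuclideanSpace.single i ((t : ℂ) * ψ i) := by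
    rw [← LinearMap.sub_apply, ← map_sub, hAA']
    ext j
    simp [toLpLin_apply, Matrix.single_mulVec, Function.update_apply]
  have hentry : inner ℂ ψ' (toEuclideanLin A ψ) - inner ℂ (toEuclideanLin A' ψ') ψ =
      (t : ℂ) * ψ i * starRingEnd ℂ (ψ' i) := by
    rw [inner_toEuclideanLin hA', ← inner_sub_right, hA, EuclideanSpace.inner_single_right]
  have hupper : |t| * (‖ψ i‖ * ‖ψ' i‖) ≤ 2 * η := by
    calc |t| * (‖ψ i‖ * ‖ψ' i‖) = ‖(t : ℂ) * ψ i * starRingEnd ℂ (ψ' i)‖ := by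
          rw [norm_mul, norm_mul, Complex.norm_real, Real.norm_eq_abs, RCLike.norm_conj, mul_assoc]
      _ ≤ ‖toEuclideanLin A ψ‖ + ‖toEuclideanLin A' ψ'‖ := by
          rw [← hentry]
          refine (norm_sub_le _ _).trans (add_le_add ?_ ?_)
          · simpa [hψ'] using norm_inner_le_norm (𝕜 := ℂ) ψ' (toEuclideanLin A ψ)
          · simpa [hψ] using norm_inner_le_norm (𝕜 := ℂ) (toEuclideanLin A' ψ') ψ
      _ ≤ 2 * η := by linarith
  have hmass : (Fintype.card n : ℝ)⁻¹ ≤ ‖ψ i‖ * ‖ψ' i‖ := by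
    refine le_of_sq_le_sq ?_ (by positivity)
    rw [mul_pow, sq]
    exact mul_le_mul hi hi' (by positivity) (by positivity)
  have hcard : (0 : ℝ) < Fintype.card n := Nat.cast_pos.2 (Fintype.card_pos_iff.2 ⟨i⟩)
  rw [← div_le_iff₀ hcard, div_eq_mul_inv]
  exact (mul_le_mul_of_nonneg_left hmass (abs_nonneg t)).trans hupper

end Matrix

/-! ### Green's functions of finite regions -/

section Green

variable {d : ℕ} {H : Matrix (Lattice d) (Lattice d) ℂ} {B Λ : Finset (Lattice d)} {E δ : ℝ}
  {u v w x y : Lattice d}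

/-- `dist (E, σ(H_B)) ≥ δ` for Hermitian `H`, see `BoundedBelow`. -/
def HasGap (H : Matrix (Lattice d) (Lattice d) ℂ) (E δ : ℝ) (B : Finset (Lattice d)) : Prop :=
  BoundedBelow (restrict H B - (E : ℂ) • (1 : Matrix B B ℂ)) δ

/-- The distance `exp (-log^{ρ'} L)` from the spectrum which makes a cube of radius `L`
non-resonant. -/
noncomputable def gapThreshold (ρ' L : ℝ) : ℝ := Real.exp (-(Real.log L) ^ ρ')

/-- The Green's function of `H_B`, extended by zero to sites outside of `B`. -/
noncomputable def greenExt (H : Matrix (Lattice d) (Lattice d) ℂ) (B : Finset (Lattice d)) (E : ℝ)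
    (w y : Lattice d) : ℂ :=
  if h : w ∈ B ∧ y ∈ B then green H B E ⟨w, h.1⟩ ⟨y, h.2⟩ else 0

theorem gapThreshold_pos (ρ' L : ℝ) : 0 < gapThreshold ρ' L := Real.exp_pos _

theorem gapThreshold_le_one {L : ℝ} (hL : 1 ≤ L) (ρ' : ℝ) : gapThreshold ρ' L ≤ 1 :=
  Real.exp_le_one_iff.2 (neg_nonpos.2 (Real.rpow_nonneg (Real.log_nonneg hL) _))

theorem restrict_isHermitian (hH : H.IsHermitian) (B : Finset (Lattice d)) :
    (restrict H B).IsHermitian :=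
  hH.submatrix _

theorem self_mem_cube (x : Lattice d) {L : ℝ} (hL : 0 ≤ L) : x ∈ cube x L := by
  simpa [mem_cube] using hL

theorem nonResonant_iff_hasGap (hH : H.IsHermitian) {ρ' L : ℝ} (hL : 0 ≤ L) :
    NonResonant H ρ' E x L ↔ HasGap H E (gapThreshold ρ' L) (cube x L) := by
  have : Nonempty (cube x L) := ⟨⟨x, self_mem_cube x hL⟩⟩
  exact le_infDist_spectrum_iff (restrict_isHermitian hH _) (gapThreshold_pos ρ' L).le

theorem greenExt_of_mem (hw : w ∈ B) (hy : y ∈ B) :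
    greenExt H B E w y = green H B E ⟨w, hw⟩ ⟨y, hy⟩ := by
  simp [greenExt, hw, hy]

theorem HasGap.norm_greenExt_le (h : HasGap H E δ B) (hδ : 0 < δ) (w y : Lattice d) :
    ‖greenExt H B E w y‖ ≤ δ⁻¹ := by
  unfold greenExt
  split_ifs
  · exact h.norm_inv_apply_le hδ _ _
  · simpa using hδ.le

theorem restrict_sub_smul_one_apply (u v : B) :
    (restrict H B - (E : ℂ) • (1 : Matrix B B ℂ)) u v =
      (H - (E : ℂ) • (1 : Matrix (Lattice d) (Lattice d) ℂ)) u v := by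
  simp only [restrict, Matrix.sub_apply, Matrix.smul_apply, Matrix.one_apply, submatrix_apply,
    Subtype.ext_iff]

theorem sum_mul_greenExt (hdet : IsUnit (restrict H B - (E : ℂ) • (1 : Matrix B B ℂ)).det)
    (hu : u ∈ B) (hy : y ∈ B) :
    ∑ v ∈ B, (H - (E : ℂ) • (1 : Matrix (Lattice d) (Lattice d) ℂ)) u v * greenExt H B E v y =
      if u = y then 1 else 0 := by
  have h := congrFun (congrFun (mul_nonsing_inv _ hdet) ⟨u, hu⟩) ⟨y, hy⟩
  rw [Matrix.mul_apply, Matrix.one_apply] at h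
  simp only [Subtype.mk.injEq] at h
  rw [← h, ← Finset.sum_coe_sort B]
  refine Finset.sum_congr rfl fun v _ => ?_
  rw [restrict_sub_smul_one_apply, greenExt_of_mem v.2 hy]
  rfl

theorem sum_greenExt_mul (hdet : IsUnit (restrict H B - (E : ℂ) • (1 : Matrix B B ℂ)).det)
    (hw : w ∈ B) (hv : v ∈ B) :
    ∑ u ∈ B, greenExt H B E w u * (H - (E : ℂ) • (1 : Matrix (Lattice d) (Lattice d) ℂ)) u v =
      if w = v then 1 else 0 := by
  have h := congrFun (congrFun (nonsing_inv_mul _ hdet) ⟨w, hw⟩) ⟨v, hv⟩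
  rw [Matrix.mul_apply, Matrix.one_apply] at h
  simp only [Subtype.mk.injEq] at h
  rw [← h, ← Finset.sum_coe_sort B]
  refine Finset.sum_congr rfl fun u _ => ?_
  rw [restrict_sub_smul_one_apply, greenExt_of_mem hw u.2]
  rfl

theorem geometric_resolvent_identity (hΛB : Λ ⊆ B)
    (hΛ : IsUnit (restrict H Λ - (E : ℂ) • (1 : Matrix Λ Λ ℂ)).det)
    (hB : IsUnit (restrict H B - (E : ℂ) • (1 : Matrix B B ℂ)).det)
    (hw : w ∈ Λ) (hy : y ∈ B) (hyΛ : y ∉ Λ) :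
    greenExt H B E w y =
      -∑ u ∈ Λ, ∑ v ∈ B \ Λ, greenExt H Λ E w u * H u v * greenExt H B E v y := by
  set K := H - (E : ℂ) • (1 : Matrix (Lattice d) (Lattice d) ℂ) with hK
  have hinside : ∀ u ∈ Λ, ∑ v ∈ Λ, K u v * greenExt H B E v y =
      -∑ v ∈ B \ Λ, H u v * greenExt H B E v y := by
    intro u hu
    have h := sum_mul_greenExt hB (hΛB hu) hy
    rw [if_neg (fun huy : u = y => hyΛ (huy ▸ hu)), ← Finset.sum_sdiff hΛB] at h
    rw [eq_neg_of_add_eq_zero_right h]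
    refine congrArg Neg.neg (Finset.sum_congr rfl fun v hv => ?_)
    have huv : u ≠ v := fun huv => (Finset.mem_sdiff.1 hv).2 (huv ▸ hu)
    simp [Matrix.one_apply_ne huv]
  calc greenExt H B E w y = ∑ v ∈ Λ, (if w = v then 1 else 0) * greenExt H B E v y := by
        simp [hw]
    _ = ∑ v ∈ Λ, ∑ u ∈ Λ, greenExt H Λ E w u * (K u v * greenExt H B E v y) := by
        refine Finset.sum_congr rfl fun v hv => ?_
        rw [← sum_greenExt_mul hΛ hw hv, Finset.sum_mul]
        simp only [mul_assoc, hK]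
    _ = ∑ u ∈ Λ, greenExt H Λ E w u * -∑ v ∈ B \ Λ, H u v * greenExt H B E v y := by
        rw [Finset.sum_comm]
        refine Finset.sum_congr rfl fun u hu => ?_
        rw [← Finset.mul_sum, hinside u hu]
    _ = _ := by
        simp only [mul_neg, Finset.sum_neg_distrib, Finset.mul_sum, mul_assoc]

theorem exists_norm_greenExt_le_mul (hΛB : Λ ⊆ B)
    (hΛ : IsUnit (restrict H Λ - (E : ℂ) • (1 : Matrix Λ Λ ℂ)).det)
    (hB : IsUnit (restrict H B - (E : ℂ) • (1 : Matrix B B ℂ)).det)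
    (hw : w ∈ Λ) (hy : y ∈ B) (hyΛ : y ∉ Λ) :
    ∃ u ∈ Λ, ∃ v ∈ B \ Λ, ‖greenExt H B E w y‖ ≤
      (B.card : ℝ) ^ 2 * (‖greenExt H Λ E w u‖ * ‖H u v‖ * ‖greenExt H B E v y‖) := by
  let F : Lattice d × Lattice d → ℝ := fun q =>
    ‖greenExt H Λ E w q.1‖ * ‖H q.1 q.2‖ * ‖greenExt H B E q.2 y‖
  obtain ⟨⟨u, v⟩, huv, hmax⟩ := Finset.exists_max_image (Λ ×ˢ (B \ Λ)) F
    ⟨(w, y), by simp [hw, hy, hyΛ]⟩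
  obtain ⟨hu, hv⟩ := Finset.mem_product.1 huv
  refine ⟨u, hu, v, hv, ?_⟩
  calc ‖greenExt H B E w y‖ ≤ ∑ q ∈ Λ ×ˢ (B \ Λ), F q := by
        rw [geometric_resolvent_identity hΛB hΛ hB hw hy hyΛ, norm_neg, ← Finset.sum_product']
        exact (norm_sum_le _ _).trans_eq (by simp only [F, norm_mul])
    _ ≤ (Λ ×ˢ (B \ Λ)).card * F (u, v) := by
        simpa only [nsmul_eq_mul] using Finset.sum_le_card_nsmul _ _ _ hmax
    _ ≤ (B.card : ℝ) ^ 2 * F (u, v) := by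
        have hF : 0 ≤ F (u, v) := by positivity
        rw [Finset.card_product, Nat.cast_mul, sq]
        gcongr
        exact Finset.sdiff_subset

end Green

/-! ### Decay of Green's functions across scales -/

section Hops

variable {d : ℕ} {H : Matrix (Lattice d) (Lattice d) ℂ} {B Λ : Finset (Lattice d)}
  {κ κ' ρ ρ' E δ A l L r : ℝ} {u v w x y : Lattice d}

/-- The decay profile `exp (-κ log^ρ r)`. -/
noncomputable def logDecay (κ ρ r : ℝ) : ℝ := Real.exp (-κ * (Real.log r) ^ ρ)

/-- The off-diagonal decay of the matrices considered here. The diagonal is exempt since it carries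
the potential. -/
def OffDiagDecay (H : Matrix (Lattice d) (Lattice d) ℂ) (κ ρ : ℝ) : Prop :=
  ∀ u v, u ≠ v → ‖H u v‖ ≤ logDecay κ ρ (‖u - v‖ + 1)

/-- The distance one can travel from `w` before leaving `cube x L` or reaching `y`. -/
noncomputable def clearance (L : ℝ) (x y w : Lattice d) : ℝ := min (L - ‖w - x‖) ‖w - y‖

/-- `B` contains four points with `Q` at mutual distances larger than `r`. -/
def HasFourSeparated (Q : Lattice d → Prop) (r : ℝ) (B : Finset (Lattice d)) : Prop :=
  ∃ z : Fin 4 → Lattice d, (∀ i, z i ∈ B) ∧ (Pairwise fun i j => r < ‖z i - z j‖) ∧ ∀ i, Q (z i)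

/-- The regions of `cube x L` which have to be free of resonances in the step from the scale `l` to
the scale `L`. -/
noncomputable def subregions (l L : ℝ) (x : Lattice d) : Finset (Finset (Lattice d)) :=
  insert (cube x L)
    ((cube x L ×ˢ Finset.Icc 1 4).image fun q => cube q.1 (10 * (q.2 : ℕ) * l) ∩ cube x L)

/-- The energy `E` is within `δ` of the spectrum of one of the `subregions` of `cube x L`. -/
def Resonant (H : Matrix (Lattice d) (Lattice d) ℂ) (E δ l L : ℝ) (x : Lattice d) : Prop :=
  ∃ Λ ∈ subregions l L x, ¬HasGap H E δ Λ

theorem logDecay_pos (κ ρ r : ℝ) : 0 < logDecay κ ρ r := Real.exp_pos _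

theorem logDecay_antitoneOn (hκ : 0 ≤ κ) (hρ : 0 ≤ ρ) :
    AntitoneOn (logDecay κ ρ) (Set.Ici 1) := by
  intro r (hr : 1 ≤ r) s _ hrs
  have hlog : (Real.log r) ^ ρ ≤ (Real.log s) ^ ρ :=
    Real.rpow_le_rpow (Real.log_nonneg hr) (Real.log_le_log (by linarith) hrs) hρ
  exact Real.exp_le_exp.2 (mul_le_mul_of_nonpos_left hlog (neg_nonpos.2 hκ))

theorem logDecay_anti_left (hκ : κ ≤ κ') (hr : 1 ≤ r) : logDecay κ' ρ r ≤ logDecay κ ρ r :=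
  Real.exp_le_exp.2 (mul_le_mul_of_nonneg_right (neg_le_neg hκ)
    (Real.rpow_nonneg (Real.log_nonneg hr) ρ))

theorem logDecay_le_one (hκ : 0 ≤ κ) (hr : 1 ≤ r) : logDecay κ ρ r ≤ 1 :=
  (logDecay_anti_left hκ hr).trans_eq (by simp [logDecay])

theorem OffDiagDecay.mono (h : OffDiagDecay H κ' ρ) (hκ : κ ≤ κ') : OffDiagDecay H κ ρ :=
  fun u v huv => (h u v huv).trans (logDecay_anti_left hκ (by simp))

theorem OffDiagDecay.norm_le_one (h : OffDiagDecay H κ ρ) (hκ : 0 ≤ κ) (huv : u ≠ v) :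
    ‖H u v‖ ≤ 1 :=
  (h u v huv).trans (logDecay_le_one hκ (by simp))

theorem Good.mono (h : Good H ρ ρ' κ' E x L) (hκ : κ ≤ κ') : Good H ρ ρ' κ E x L :=
  ⟨h.1, fun hx y hy hxy => (h.2 hx y hy hxy).trans (logDecay_anti_left hκ (by simp))⟩

theorem clearance_le_add (L : ℝ) (x y v w : Lattice d) :
    clearance L x y w ≤ clearance L x y v + ‖v - w‖ := by
  have hx : ‖v - x‖ ≤ ‖v - w‖ + ‖w - x‖ := norm_sub_le_norm_sub_add_norm_sub _ _ _
  have hy : ‖w - y‖ ≤ ‖w - v‖ + ‖v - y‖ := norm_sub_le_norm_sub_add_norm_sub _ _ _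
  rw [norm_sub_rev w v] at hy
  rw [clearance, clearance, ← min_add_add_right]
  exact min_le_min (by linarith) (by linarith)

theorem clearance_self (hy : y ∈ cube x L) : clearance L x y x = ‖y - x‖ := by
  simpa [clearance, norm_sub_rev x y] using mem_cube.1 hy

theorem cube_subset_of_le_clearance (h : r ≤ clearance L x y w) : cube w r ⊆ cube x L := by
  intro v hv
  rw [mem_cube] at hv ⊢
  have hvx : ‖v - x‖ ≤ ‖v - w‖ + ‖w - x‖ := norm_sub_le_norm_sub_add_norm_sub _ _ _
  linarith [(le_min_iff.1 h).1]

theorem notMem_cube_of_lt_clearance (h : r < clearance L x y w) : y ∉ cube w r := by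
  rw [mem_cube, norm_sub_rev, not_le]
  exact (lt_min_iff.1 h).2

theorem hasGap_of_not_resonant (h : ¬Resonant H E δ l L x) (hΛ : Λ ∈ subregions l L x) :
    HasGap H E δ Λ := by
  by_contra hgap
  exact h ⟨Λ, hΛ, hgap⟩

theorem cube_mem_subregions (l L : ℝ) (x : Lattice d) : cube x L ∈ subregions l L x :=
  Finset.mem_insert_self _ _

theorem inter_cube_mem_subregions (hw : w ∈ cube x L) {k : ℕ} (hk : k ∈ Finset.Icc 1 4) :
    cube w (10 * k * l) ∩ cube x L ∈ subregions l L x :=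
  Finset.mem_insert_of_mem
    (Finset.mem_image.2 ⟨(w, k), Finset.mem_product.2 ⟨hw, hk⟩, rfl⟩)

theorem subset_of_mem_subregions (h : Λ ∈ subregions l L x) : Λ ⊆ cube x L := by
  rw [subregions, Finset.mem_insert, Finset.mem_image] at h
  rcases h with rfl | ⟨q, -, rfl⟩
  · exact subset_rfl
  · exact Finset.inter_subset_right

theorem card_subregions_le (l : ℝ) (hL : 0 ≤ L) (x : Lattice d) :
    (subregions l L x).card ≤ 5 * (cube x L).card := by
  have hinsert : (subregions l L x).card ≤ (cube x L ×ˢ Finset.Icc 1 4).card + 1 :=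
    (Finset.card_insert_le _ _).trans (Nat.add_le_add_right Finset.card_image_le 1)
  have hpos : 0 < (cube x L).card := Finset.card_pos.2 ⟨x, self_mem_cube x hL⟩
  rw [Finset.card_product, Nat.card_Icc] at hinsert
  omega

/-- Among four disjoint annuli around `w` one contains no points of `Q`, or else picking a point of
`Q` in each of them gives four separated points. -/
theorem exists_annulus {Q : Lattice d → Prop} (hl : 0 ≤ l) (hQ : ¬HasFourSeparated Q (2 * l) B)
    (w : Lattice d) :
    ∃ k ∈ Finset.Icc (1 : ℕ) 4,
      ∀ v ∈ B, 10 * k * l < ‖v - w‖ → ‖v - w‖ ≤ 10 * k * l + l → ¬Q v := by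
  by_contra! hcon
  have hpoint : ∀ i : Fin 4, ∃ v ∈ B, 10 * ((i : ℝ) + 1) * l < ‖v - w‖ ∧
      ‖v - w‖ ≤ 10 * ((i : ℝ) + 1) * l + l ∧ Q v := by
    intro i
    exact_mod_cast hcon (i + 1) (Finset.mem_Icc.2 ⟨by omega, by omega⟩)
  choose z hzB hzlt hzle hzQ using hpoint
  have hsep : ∀ i j : Fin 4, i < j → 2 * l < ‖z i - z j‖ := by
    intro i j hij
    have htri : ‖z j - w‖ ≤ ‖z j - z i‖ + ‖z i - w‖ := norm_sub_le_norm_sub_add_norm_sub _ _ _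
    have hij' : ((i : ℝ) + 1) * l ≤ (j : ℝ) * l :=
      mul_le_mul_of_nonneg_right (by exact_mod_cast hij) hl
    rw [norm_sub_rev]
    linarith [hzlt j, hzle i]
  refine hQ ⟨z, hzB, fun i j hij => ?_, hzQ⟩
  rcases lt_or_gt_of_ne hij with h | h
  · exact hsep i j h
  · simpa only [norm_sub_rev] using hsep j i h

theorem exists_gap_hop (hδ : 0 < δ) (hA : (B.card : ℝ) ^ 2 * δ⁻¹ ≤ A) (hΛB : Λ ⊆ B)
    (hΛ : HasGap H E δ Λ) (hB : HasGap H E δ B) (hw : w ∈ Λ) (hy : y ∈ B) (hyΛ : y ∉ Λ) :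
    ∃ u ∈ Λ, ∃ v ∈ B \ Λ,
      ‖greenExt H B E w y‖ ≤ A * (‖H u v‖ * ‖greenExt H B E v y‖) := by
  obtain ⟨u, hu, v, hv, hle⟩ :=
    exists_norm_greenExt_le_mul hΛB (hΛ.isUnit_det hδ) (hB.isUnit_det hδ) hw hy hyΛ
  refine ⟨u, hu, v, hv, hle.trans ?_⟩
  calc _ ≤ (B.card : ℝ) ^ 2 * (δ⁻¹ * ‖H u v‖ * ‖greenExt H B E v y‖) := by
        gcongr
        exact hΛ.norm_greenExt_le hδ w u
    _ = (B.card : ℝ) ^ 2 * δ⁻¹ * (‖H u v‖ * ‖greenExt H B E v y‖) := by ring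
    _ ≤ _ := by gcongr

/-- Either the Green's function of the good cube decays over half of the hop, or the hopping term
does. -/
theorem Good.norm_greenExt_mul_norm_le (hH : H.IsHermitian) (hoff : OffDiagDecay H κ ρ)
    (hκ : 0 ≤ κ) (hρ : 0 ≤ ρ) (hl : 2 ≤ l) (hl' : l ^ (4 / 5 : ℝ) ≤ l / 2) (hδ : 0 < δ)
    (hδl : δ ≤ gapThreshold ρ' l) (hgood : Good H ρ ρ' κ E w l) (hu : u ∈ cube w l)
    (hv : v ∉ cube w l) :
    ‖greenExt H (cube w l) E w u‖ * ‖H u v‖ ≤ δ⁻¹ * logDecay κ ρ (‖v - w‖ / 2) := by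
  have huv : u ≠ v := fun h => hv (h ▸ hu)
  rw [mem_cube, not_le] at hv
  have hdecay : ∀ r, ‖v - w‖ / 2 ≤ r + 1 → logDecay κ ρ (r + 1) ≤ logDecay κ ρ (‖v - w‖ / 2) :=
    fun r hr => logDecay_antitoneOn hκ hρ (Set.mem_Ici.2 (by linarith))
      (Set.mem_Ici.2 (by linarith)) hr
  by_cases hfar : ‖v - w‖ / 2 ≤ ‖u - w‖
  · have hw : w ∈ cube w l := self_mem_cube w (by linarith)
    have hgreen : ‖greenExt H (cube w l) E w u‖ ≤ logDecay κ ρ (‖u - w‖ + 1) := by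
      rw [greenExt_of_mem hw hu, norm_sub_rev]
      exact hgood.2 hw u hu (by linarith)
    have hδinv : 1 ≤ δ⁻¹ :=
      (one_le_inv₀ hδ).2 (hδl.trans (gapThreshold_le_one (by linarith) ρ'))
    calc _ ≤ logDecay κ ρ (‖v - w‖ / 2) * 1 :=
          mul_le_mul (hgreen.trans (hdecay _ (by linarith))) (hoff.norm_le_one hκ huv)
            (norm_nonneg _) (logDecay_pos _ _ _).le
      _ ≤ _ := by
          rw [mul_comm]
          exact mul_le_mul_of_nonneg_right hδinv (logDecay_pos _ _ _).le
  · have hgap : HasGap H E δ (cube w l) :=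
      ((nonResonant_iff_hasGap hH (by linarith)).1 hgood.1).mono hδl
    have htri : ‖v - w‖ ≤ ‖v - u‖ + ‖u - w‖ := norm_sub_le_norm_sub_add_norm_sub v u w
    rw [norm_sub_rev v u] at htri
    exact mul_le_mul (hgap.norm_greenExt_le hδ _ _)
      ((hoff u v huv).trans (hdecay _ (by linarith))) (norm_nonneg _) (by positivity)

theorem exists_good_hop (hH : H.IsHermitian) (hoff : OffDiagDecay H κ ρ) (hκ : 0 ≤ κ) (hρ : 0 ≤ ρ)
    (hl : 2 ≤ l) (hl' : l ^ (4 / 5 : ℝ) ≤ l / 2) (hδ : 0 < δ) (hδl : δ ≤ gapThreshold ρ' l)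
    (hA : (B.card : ℝ) ^ 2 * δ⁻¹ ≤ A) (hB : HasGap H E δ B) (hwB : cube w l ⊆ B)
    (hgood : Good H ρ ρ' κ E w l) (hy : y ∈ B) (hyw : y ∉ cube w l) :
    ∃ v, l < ‖v - w‖ ∧ ‖greenExt H B E w y‖ ≤
      A * (logDecay κ ρ (‖v - w‖ / 2) * ‖greenExt H B E v y‖) := by
  have hΛ : HasGap H E δ (cube w l) :=
    ((nonResonant_iff_hasGap hH (by linarith)).1 hgood.1).mono hδl
  obtain ⟨u, hu, v, hv, hle⟩ := exists_norm_greenExt_le_mul hwB (hΛ.isUnit_det hδ)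
    (hB.isUnit_det hδ) (self_mem_cube w (by linarith)) hy hyw
  obtain ⟨-, hvw⟩ := Finset.mem_sdiff.1 hv
  have hdecay := hgood.norm_greenExt_mul_norm_le hH hoff hκ hρ hl hl' hδ hδl hu hvw
  rw [mem_cube, not_le] at hvw
  refine ⟨v, hvw, hle.trans ?_⟩
  calc _ ≤ (B.card : ℝ) ^ 2 *
        (δ⁻¹ * logDecay κ ρ (‖v - w‖ / 2) * ‖greenExt H B E v y‖) := by gcongr
    _ = (B.card : ℝ) ^ 2 * δ⁻¹ * (logDecay κ ρ (‖v - w‖ / 2) * ‖greenExt H B E v y‖) := by ring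
    _ ≤ _ := mul_le_mul_of_nonneg_right hA (mul_nonneg (logDecay_pos _ _ _).le (norm_nonneg _))

theorem exists_annulus_hop (hδ : 0 < δ) (hl : 0 ≤ l)
    (hA : ((cube x L).card : ℝ) ^ 2 * δ⁻¹ ≤ A) (hres : ¬Resonant H E δ l L x)
    (hbad : ¬HasFourSeparated (fun z => Bad H ρ ρ' κ E z l) (2 * l) (cube x L))
    (hy : y ∈ cube x L) (hw : 40 * l < clearance L x y w) :
    ∃ u v, u ≠ v ∧ ‖v - w‖ ≤ ‖u - v‖ + 40 * l ∧
      ‖greenExt H (cube x L) E w y‖ ≤ A * (‖H u v‖ * ‖greenExt H (cube x L) E v y‖) ∧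
      (‖u - v‖ ≤ l → Good H ρ ρ' κ E v l) := by
  obtain ⟨k, hk, hann⟩ := exists_annulus hl hbad w
  have hkl : (k : ℝ) * l ≤ 4 * l :=
    mul_le_mul_of_nonneg_right (by exact_mod_cast (Finset.mem_Icc.1 hk).2) hl
  have hwB : w ∈ cube x L := cube_subset_of_le_clearance hw.le (self_mem_cube w (by linarith))
  have hΛB : cube w (10 * k * l) ⊆ cube x L := cube_subset_of_le_clearance (by linarith)
  have hΛ : HasGap H E δ (cube w (10 * k * l)) := by
    simpa only [Finset.inter_eq_left.2 hΛB] using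
      hasGap_of_not_resonant hres (inter_cube_mem_subregions hwB hk)
  obtain ⟨u, hu, v, hv, hle⟩ := exists_gap_hop hδ hA hΛB hΛ
    (hasGap_of_not_resonant hres (cube_mem_subregions l L x))
    (self_mem_cube w (by positivity)) hy (notMem_cube_of_lt_clearance (by linarith))
  obtain ⟨hvB, hvΛ⟩ := Finset.mem_sdiff.1 hv
  have htri : ‖v - w‖ ≤ ‖v - u‖ + ‖u - w‖ := norm_sub_le_norm_sub_add_norm_sub v u w
  rw [norm_sub_rev v u] at htri
  have huv : u ≠ v := fun h => hvΛ (h ▸ hu)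
  rw [mem_cube] at hu hvΛ
  exact ⟨u, v, huv, by linarith, hle,
    fun hshort => not_not.1 (hann v hvB (not_le.1 hvΛ) (by linarith))⟩

/-- After a short first hop a second one is made, out of a good cube. -/
theorem exists_far_hop (hH : H.IsHermitian) (hoff : OffDiagDecay H κ ρ) (hκ : 0 ≤ κ) (hρ : 0 ≤ ρ)
    (hl : 2 ≤ l) (hl' : l ^ (4 / 5 : ℝ) ≤ l / 2) (hδ : 0 < δ) (hδl : δ ≤ gapThreshold ρ' l)
    (hA : ((cube x L).card : ℝ) ^ 2 * δ⁻¹ ≤ A) (hA1 : 1 ≤ A) (hres : ¬Resonant H E δ l L x)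
    (hbad : ¬HasFourSeparated (fun z => Bad H ρ ρ' κ E z l) (2 * l) (cube x L))
    (hy : y ∈ cube x L) (hw : 100 * l < clearance L x y w) :
    ∃ v a, l ≤ a ∧ ‖v - w‖ ≤ 42 * a ∧ ‖greenExt H (cube x L) E w y‖ ≤
      A ^ 2 * logDecay κ ρ (a / 2) * ‖greenExt H (cube x L) E v y‖ := by
  obtain ⟨u, v, huv, hvw, hle, hshort⟩ :=
    exists_annulus_hop hδ (by linarith) hA hres hbad hy (by linarith : 40 * l < clearance L x y w)
  by_cases hlong : l < ‖u - v‖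
  · refine ⟨v, ‖u - v‖, hlong.le, by linarith, hle.trans ?_⟩
    have hdecay : ‖H u v‖ ≤ logDecay κ ρ (‖u - v‖ / 2) :=
      (hoff u v huv).trans (logDecay_antitoneOn hκ hρ (Set.mem_Ici.2 (by linarith)) (by simp)
        (by linarith))
    calc _ ≤ A ^ 2 * (logDecay κ ρ (‖u - v‖ / 2) * ‖greenExt H (cube x L) E v y‖) := by
          gcongr
          exact le_self_pow₀ hA1 two_ne_zero
      _ = _ := by ring
  · have hclear := clearance_le_add L x y v w
    obtain ⟨v', hv', hle'⟩ := exists_good_hop hH hoff hκ hρ hl hl' hδ hδl hA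
      (hasGap_of_not_resonant hres (cube_mem_subregions l L x))
      (cube_subset_of_le_clearance (by linarith)) (hshort (not_lt.1 hlong)) hy
      (notMem_cube_of_lt_clearance (by linarith))
    have htri : ‖v' - w‖ ≤ ‖v' - v‖ + ‖v - w‖ := norm_sub_le_norm_sub_add_norm_sub _ _ _
    refine ⟨v', ‖v' - v‖, hv'.le, by linarith, hle.trans ?_⟩
    calc _ ≤ A * (1 * (A * (logDecay κ ρ (‖v' - v‖ / 2) *
          ‖greenExt H (cube x L) E v' y‖))) := by
          gcongr
          exact hoff.norm_le_one hκ huv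
      _ = _ := by ring

/-- Here `R` is a budget, of which a hop of length `a` spends at most `c * a`. Either `n` hops are
made before it falls to `r₀`, or the longest of at most `n` hops is long enough. -/
theorem iterate_hops {ι : Type*} {g R : ι → ℝ} {f : ℝ → ℝ} {A r₀ l c : ℝ} (hg : ∀ w, 0 ≤ g w)
    (hgA : ∀ w, g w ≤ A) (hc : 0 ≤ c) (hl : 0 ≤ l) (hf0 : ∀ a, 0 ≤ f a)
    (hf : AntitoneOn f (Set.Ici l)) (hf1 : f l ≤ 1)
    (hop : ∀ w, r₀ < R w → ∃ v a, l ≤ a ∧ R w ≤ R v + c * a ∧ g w ≤ f a * g v) (n : ℕ) (w : ι) :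
    g w ≤ A * f l ^ n ∨ R w ≤ r₀ ∨ ∃ a, l ≤ a ∧ R w ≤ r₀ + c * n * a ∧ g w ≤ A * f a := by
  have hA : 0 ≤ A := (hg w).trans (hgA w)
  have hfl : ∀ a, l ≤ a → f a ≤ f l := fun a ha => hf Set.self_mem_Ici ha ha
  have hf_le_one : ∀ a, l ≤ a → f a ≤ 1 := fun a ha => (hfl a ha).trans hf1
  induction n generalizing w with
  | zero => exact Or.inl (by simpa using hgA w)
  | succ n ih =>
    by_cases hR : R w ≤ r₀
    · exact Or.inr (Or.inl hR)
    obtain ⟨v, a, hla, hRv, hgv⟩ := hop w (not_le.1 hR)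
    have ha : 0 ≤ a := hl.trans hla
    rcases ih v with h | h | ⟨b, hlb, hRb, hgb⟩
    · left
      calc g w ≤ f l * (A * f l ^ n) := hgv.trans (mul_le_mul (hfl a hla) h (hg v) (hf0 l))
        _ = A * f l ^ (n + 1) := by ring
    · refine Or.inr (Or.inr ⟨a, hla, ?_, ?_⟩)
      · have : 0 ≤ c * n * a := by positivity
        push_cast
        linarith
      · rw [mul_comm]
        exact hgv.trans (mul_le_mul_of_nonneg_left (hgA v) (hf0 a))
    · refine Or.inr (Or.inr ⟨max a b, hla.trans (le_max_left _ _), ?_, ?_⟩)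
      · have hb : c * n * b ≤ c * n * max a b := by gcongr; exact le_max_right _ _
        have ha : c * a ≤ c * max a b := by gcongr; exact le_max_left _ _
        push_cast
        linarith
      · have hgw : g w ≤ A * (f a * f b) :=
          (hgv.trans (mul_le_mul_of_nonneg_left hgb (hf0 a))).trans_eq (by ring)
        refine hgw.trans (mul_le_mul_of_nonneg_left ?_ hA)
        rcases max_choice a b with hmax | hmax <;> rw [hmax]
        · exact mul_le_of_le_one_right (hf0 a) (hf_le_one b hlb)
        · exact mul_le_of_le_one_left (hf0 b) (hf_le_one a hla)

theorem greenExt_decay_alternative (hH : H.IsHermitian) (hoff : OffDiagDecay H κ ρ) (hκ : 0 ≤ κ)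
    (hρ : 0 ≤ ρ) (hl : 2 ≤ l) (hl' : l ^ (4 / 5 : ℝ) ≤ l / 2) (hδ : 0 < δ)
    (hδl : δ ≤ gapThreshold ρ' l) (hA : ((cube x L).card : ℝ) ^ 2 * δ⁻¹ ≤ A)
    (hAl : A ^ 2 * logDecay κ ρ (l / 2) ≤ 1) (hres : ¬Resonant H E δ l L x)
    (hbad : ¬HasFourSeparated (fun z => Bad H ρ ρ' κ E z l) (2 * l) (cube x L))
    (hy : y ∈ cube x L) (hxy : 100 * l < ‖y - x‖) (n : ℕ) :
    ‖greenExt H (cube x L) E x y‖ ≤ A * (A ^ 2 * logDecay κ ρ (l / 2)) ^ n ∨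
    ∃ a, l ≤ a ∧ ‖y - x‖ ≤ 100 * l + 42 * n * a ∧
      ‖greenExt H (cube x L) E x y‖ ≤ A * (A ^ 2 * logDecay κ ρ (a / 2)) := by
  have hcard : (1 : ℝ) ≤ (cube x L).card := by exact_mod_cast Finset.card_pos.2 ⟨y, hy⟩
  have hδA : δ⁻¹ ≤ A :=
    (le_mul_of_one_le_left (by positivity) (one_le_pow₀ hcard)).trans hA
  have hA1 : 1 ≤ A :=
    ((one_le_inv₀ hδ).2 (hδl.trans (gapThreshold_le_one (by linarith) ρ'))).trans hδA
  have hB : HasGap H E δ (cube x L) := hasGap_of_not_resonant hres (cube_mem_subregions l L x)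
  have hanti : AntitoneOn (fun a => A ^ 2 * logDecay κ ρ (a / 2)) (Set.Ici l) := by
    intro a (ha : l ≤ a) b (hb : l ≤ b) hab
    exact mul_le_mul_of_nonneg_left (logDecay_antitoneOn hκ hρ (Set.mem_Ici.2 (by linarith))
      (Set.mem_Ici.2 (by linarith)) (by linarith)) (sq_nonneg A)
  have hhop : ∀ w, 100 * l < clearance L x y w → ∃ v a, l ≤ a ∧
      clearance L x y w ≤ clearance L x y v + 42 * a ∧ ‖greenExt H (cube x L) E w y‖ ≤
        A ^ 2 * logDecay κ ρ (a / 2) * ‖greenExt H (cube x L) E v y‖ := by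
    intro w hw
    obtain ⟨v, a, hla, hva, hle⟩ :=
      exists_far_hop hH hoff hκ hρ hl hl' hδ hδl hA hA1 hres hbad hy hw
    exact ⟨v, a, hla, (clearance_le_add L x y v w).trans (by linarith), hle⟩
  rcases iterate_hops (fun w => norm_nonneg (greenExt H (cube x L) E w y))
    (fun w => (hB.norm_greenExt_le hδ w y).trans hδA) (by norm_num) (by linarith)
    (fun a => mul_nonneg (sq_nonneg A) (logDecay_pos _ _ _).le) hanti hAl hhop n x with h | h | h
  · exact Or.inl h
  · rw [clearance_self hy] at h
    linarith
  · rw [clearance_self hy] at h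
    exact Or.inr h

end Hops

/-! ### The deterministic step from scale `l` to scale `L` -/

section LargeScale

variable {d : ℕ}

theorem eventually_mul_rpow_le_mul_rpow {a b : ℝ} (hab : a < b) (C : ℝ) {c : ℝ} (hc : 0 < c) :
    ∀ᶠ m : ℝ in atTop, C * m ^ a ≤ c * m ^ b := by
  have h : Tendsto (fun m : ℝ => C * m ^ (-(b - a))) atTop (𝓝 (C * 0)) :=
    (tendsto_rpow_neg_atTop (sub_pos.2 hab)).const_mul C
  rw [mul_zero] at h
  filter_upwards [h.eventually (ge_mem_nhds hc), eventually_gt_atTop 0] with m hm hm0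
  calc C * m ^ a = C * m ^ (-(b - a)) * m ^ b := by
        rw [mul_assoc, ← Real.rpow_add hm0]; congr 2; ring
    _ ≤ c * m ^ b := mul_le_mul_of_nonneg_right hm (Real.rpow_nonneg hm0.le _)

theorem eventually_mul_rpow_le_exp_mul_log_rpow (C q : ℝ) {c r : ℝ} (hc : 0 < c) (hr : 1 < r) :
    ∀ᶠ L : ℝ in atTop, C * L ^ q ≤ Real.exp (c * (Real.log L) ^ r) := by
  have hlog : ∀ᶠ m : ℝ in atTop, (1 + q) * m ^ (1 : ℝ) ≤ c * m ^ r :=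
    eventually_mul_rpow_le_mul_rpow hr _ hc
  filter_upwards [Real.tendsto_log_atTop.eventually hlog, eventually_gt_atTop 0,
    eventually_ge_atTop C] with L hlogL hL hC
  rw [Real.rpow_one] at hlogL
  calc C * L ^ q ≤ L * L ^ q := by gcongr
    _ = Real.exp ((1 + q) * Real.log L) := by
        rw [mul_comm (1 + q), ← Real.rpow_def_of_pos hL, Real.rpow_add hL, Real.rpow_one]
    _ ≤ Real.exp (c * (Real.log L) ^ r) := Real.exp_le_exp.2 hlogL

theorem rpow_mul_one_sub_le_sub_rpow {ρ c T : ℝ} (hρ : 1 ≤ ρ) (hT : 0 < T) (hcT : c ≤ T) :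
    T ^ ρ * (1 - ρ * (c / T)) ≤ (T - c) ^ ρ := by
  have hneg : -1 ≤ -(c / T) := neg_le_neg ((div_le_one hT).2 hcT)
  have hbernoulli := one_add_mul_self_le_rpow_one_add hneg hρ
  calc T ^ ρ * (1 - ρ * (c / T)) ≤ T ^ ρ * (1 + -(c / T)) ^ ρ :=
        mul_le_mul_of_nonneg_left (by linarith) (Real.rpow_nonneg hT.le _)
    _ = (T - c) ^ ρ := by
        rw [← Real.mul_rpow hT.le (by linarith)]
        congr 1
        field_simp
        ring

theorem eventually_half_rpow_le_sub_rpow {ρ : ℝ} (hρ : 1 ≤ ρ) (c : ℝ) :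
    ∀ᶠ m : ℝ in atTop, m ^ ρ / 2 ≤ (m - c) ^ ρ := by
  filter_upwards [eventually_ge_atTop (2 * ρ * c), eventually_ge_atTop c, eventually_gt_atTop 0]
    with m hm hcm hm0
  have hsmall : ρ * (c / m) ≤ 1 / 2 := by
    rw [← mul_div_assoc, div_le_iff₀ hm0]; linarith
  refine le_trans ?_ (rpow_mul_one_sub_le_sub_rpow hρ hm0 hcm)
  rw [div_eq_mul_one_div]
  exact mul_le_mul_of_nonneg_left (by linarith) (Real.rpow_nonneg hm0.le _)

theorem card_cube_le (x : Lattice d) {L : ℝ} (hL : 1 ≤ L) :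
    ((cube x L).card : ℝ) ≤ (3 * L) ^ d := by
  have hfl : 0 ≤ ⌊L⌋ := Int.floor_nonneg.2 (by linarith)
  have hsub : cube x L ⊆ Fintype.piFinset fun i => Finset.Icc (x i - ⌊L⌋) (x i + ⌊L⌋) := by
    intro y hy
    rw [mem_cube, pi_norm_le_iff_of_nonneg (by linarith)] at hy
    rw [Fintype.mem_piFinset]
    intro i
    have hyi := hy i
    rw [Pi.sub_apply, Int.norm_eq_abs, ← Int.cast_abs, ← Int.le_floor, abs_le] at hyi
    rw [Finset.mem_Icc]
    omega
  have hcard : (cube x L).card ≤ (2 * ⌊L⌋ + 1).toNat ^ d := by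
    refine (Finset.card_le_card hsub).trans_eq ?_
    rw [Fintype.card_piFinset]
    simp only [Int.card_Icc]
    have hside (i : Fin d) : x i + ⌊L⌋ + 1 - (x i - ⌊L⌋) = 2 * ⌊L⌋ + 1 := by ring
    simp only [hside, Finset.prod_const, Finset.card_univ, Fintype.card_fin]
  have hside : (((2 * ⌊L⌋ + 1).toNat : ℕ) : ℝ) ≤ 3 * L := by
    have hcast : (((2 * ⌊L⌋ + 1).toNat : ℕ) : ℤ) = 2 * ⌊L⌋ + 1 := Int.toNat_of_nonneg (by omega)
    have hcast' : (((2 * ⌊L⌋ + 1).toNat : ℕ) : ℝ) = 2 * (⌊L⌋ : ℝ) + 1 := by exact_mod_cast hcast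
    rw [hcast']
    linarith [Int.floor_le L]
  calc ((cube x L).card : ℝ) ≤ ((2 * ⌊L⌋ + 1).toNat : ℝ) ^ d := by exact_mod_cast hcard
    _ ≤ (3 * L) ^ d := pow_le_pow_left₀ (Nat.cast_nonneg _) hside d

/-- The decay rate of good cubes at the scale `L`. It decreases to `κinf`, slowly enough that
the loss between consecutive scales absorbs the errors of the deterministic step. -/
noncomputable def rate (κ₀ κinf σ L : ℝ) : ℝ := κinf + (κ₀ - κinf) * (Real.log L) ^ (-σ)

theorem le_rate {κ₀ κinf σ L : ℝ} (hκ : κinf ≤ κ₀) (hL : 1 ≤ L) : κinf ≤ rate κ₀ κinf σ L :=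
  le_add_of_nonneg_right
    (mul_nonneg (sub_nonneg.2 hκ) (Real.rpow_nonneg (Real.log_nonneg hL) _))

theorem rate_le {κ₀ κinf σ L : ℝ} (hκ : κinf ≤ κ₀) (hσ : 0 ≤ σ) (hL : 1 ≤ Real.log L) :
    rate κ₀ κinf σ L ≤ κ₀ := by
  have hle : (Real.log L) ^ (-σ) ≤ 1 := Real.rpow_le_one_of_one_le_of_nonpos hL (by linarith)
  have := mul_le_mul_of_nonneg_left hle (sub_nonneg.2 hκ)
  unfold rate
  linarith

theorem rate_add_gap_le {κ₀ κinf σ l L : ℝ} (hκ : κinf ≤ κ₀) (hσ : 0 ≤ σ) (hl : 0 < Real.log l)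
    (hlL : 5 / 4 * Real.log l ≤ Real.log L) :
    rate κ₀ κinf σ L + (κ₀ - κinf) * (1 - (5 / 4 : ℝ) ^ (-σ)) * (Real.log l) ^ (-σ) ≤
      rate κ₀ κinf σ l := by
  have hle : (Real.log L) ^ (-σ) ≤ (5 / 4 : ℝ) ^ (-σ) * (Real.log l) ^ (-σ) := by
    rw [← Real.mul_rpow (by norm_num) hl.le]
    exact Real.rpow_le_rpow_of_nonpos (by linarith) hlL (by linarith)
  have := mul_le_mul_of_nonneg_left hle (sub_nonneg.2 hκ)
  unfold rate
  linarith

theorem eventually_short_hop_le {ρ ρ' κinf : ℝ} (hρ : 1 ≤ ρ) (hρ'ρ : ρ' < ρ) (hκinf : 0 < κinf)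
    (C : ℝ) :
    ∀ᶠ l : ℝ in atTop, ∀ κ, κinf ≤ κ →
      Real.exp (C * (Real.log l) ^ ρ') ^ 2 * logDecay κ ρ (l / 2) ≤
        Real.exp (-(κ / 4 * (Real.log l) ^ ρ)) := by
  filter_upwards [eventually_ge_atTop 1, Real.tendsto_log_atTop.eventually
      (eventually_mul_rpow_le_mul_rpow hρ'ρ (2 * C) (c := κinf / 4) (by linarith)),
    Real.tendsto_log_atTop.eventually (eventually_half_rpow_le_sub_rpow hρ (Real.log 2))]
    with l hl hC hhalf κ hκ
  have hlog : 0 ≤ (Real.log l) ^ ρ := Real.rpow_nonneg (Real.log_nonneg hl) _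
  rw [logDecay, Real.log_div (by linarith) two_ne_zero, ← Real.exp_nat_mul, ← Real.exp_add,
    Real.exp_le_exp]
  have h₁ : κinf / 4 * (Real.log l) ^ ρ ≤ κ / 4 * (Real.log l) ^ ρ :=
    mul_le_mul_of_nonneg_right (by linarith) hlog
  have h₂ : κ * ((Real.log l) ^ ρ / 2) ≤ κ * (Real.log l - Real.log 2) ^ ρ :=
    mul_le_mul_of_nonneg_left hhalf (by linarith)
  push_cast
  linarith

theorem eventually_iterated_hop_le {ρ ρ' κinf : ℝ} (hρ : 1 ≤ ρ) (hρ'ρ : ρ' < ρ)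
    (hκinf : 0 < κinf) (C : ℝ) {N : ℕ} (hN : 4 * (3 ^ ρ + 1) ≤ (N : ℝ)) :
    ∀ᶠ l : ℝ in atTop, ∀ κ κ' r, κinf ≤ κ → κ' ≤ κ → 1 ≤ r → r ≤ l ^ (3 : ℝ) →
      Real.exp (C * (Real.log l) ^ ρ') *
          (Real.exp (C * (Real.log l) ^ ρ') ^ 2 * logDecay κ ρ (l / 2)) ^ N ≤
        logDecay κ' ρ r := by
  filter_upwards [eventually_gt_atTop 1, eventually_short_hop_le hρ hρ'ρ hκinf C,
    Real.tendsto_log_atTop.eventually (eventually_mul_rpow_le_mul_rpow hρ'ρ C hκinf)]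
    with l hl hshort hC κ κ' r hκ hκ' hr hrl
  have hl0 : 0 < l := by linarith
  have hlog : 0 ≤ Real.log l := Real.log_nonneg hl.le
  have hlogr : (Real.log r) ^ ρ ≤ 3 ^ ρ * (Real.log l) ^ ρ := by
    rw [← Real.mul_rpow (by norm_num) hlog]
    exact Real.rpow_le_rpow (Real.log_nonneg hr)
      ((Real.le_rpow_iff_log_le (by linarith) hl0).1 hrl) (by linarith)
  have hκr : κ' * (Real.log r) ^ ρ ≤ κ * (3 ^ ρ * (Real.log l) ^ ρ) :=
    mul_le_mul hκ' hlogr (Real.rpow_nonneg (Real.log_nonneg hr) _) (by linarith)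
  have hκl : 0 ≤ κ / 4 * (Real.log l) ^ ρ :=
    mul_nonneg (by linarith) (Real.rpow_nonneg hlog _)
  have hκinfl : κinf * (Real.log l) ^ ρ ≤ κ * (Real.log l) ^ ρ :=
    mul_le_mul_of_nonneg_right hκ (Real.rpow_nonneg hlog _)
  have hNκ := mul_le_mul_of_nonneg_right hN hκl
  calc _ ≤ Real.exp (C * (Real.log l) ^ ρ') * Real.exp (-(κ / 4 * (Real.log l) ^ ρ)) ^ N := by
        gcongr
        · exact mul_nonneg (sq_nonneg _) (logDecay_pos _ _ _).le
        · exact hshort κ hκ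
    _ ≤ logDecay κ' ρ r := by
        rw [logDecay, ← Real.exp_nat_mul, ← Real.exp_add, Real.exp_le_exp]
        linarith

theorem eventually_long_hop_le {ρ ρ' κ₀ σ C D : ℝ} (hρ : 1 ≤ ρ) (hκ₀ : 0 ≤ κ₀) (hσ1 : σ < 1)
    (hσρ : σ < ρ - ρ') (hC : 0 ≤ C) (hD : 0 < D) (K : ℝ) (hK : 1 ≤ K) :
    ∀ᶠ l : ℝ in atTop, ∀ κ κ' b r, 0 ≤ κ → κ ≤ κ₀ → κ' + D * (Real.log l) ^ (-σ) ≤ κ →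
      l ≤ r → r ≤ K * b →
      Real.exp (C * (Real.log l) ^ ρ') *
          (Real.exp (C * (Real.log l) ^ ρ') ^ 2 * logDecay κ ρ b) ≤ logDecay κ' ρ r := by
  set c := Real.log K
  have hc : 0 ≤ c := Real.log_nonneg hK
  filter_upwards [eventually_gt_atTop 0,
    Real.tendsto_log_atTop.eventually (eventually_mul_rpow_le_mul_rpow (a := -1) (b := -σ)
      (by linarith) (κ₀ * ρ * c) (half_pos hD)),
    Real.tendsto_log_atTop.eventually (eventually_mul_rpow_le_mul_rpow (a := ρ' - ρ) (b := -σ)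
      (by linarith) (3 * C) (half_pos hD)),
    Real.tendsto_log_atTop.eventually (eventually_gt_atTop 0),
    Real.tendsto_log_atTop.eventually (eventually_ge_atTop c)]
    with l hl hshift hvol hm0 hcm κ κ' b r hκ hκκ₀ hκ' hlr hrb
  set m := Real.log l
  set T := Real.log r
  have hmT : m ≤ T := Real.log_le_log hl hlr
  have hT0 : 0 < T := hm0.trans_le hmT
  have hTb : (T - c) ^ ρ ≤ (Real.log b) ^ ρ := by
    refine Real.rpow_le_rpow (by linarith) ?_ (by linarith)
    have hb : 0 < b := pos_of_mul_pos_right ((hl.trans_le hlr).trans_le hrb) (by linarith)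
    have := Real.log_le_log (hl.trans_le hlr) hrb
    rw [Real.log_mul (by linarith) hb.ne'] at this
    linarith
  have hvolT : 3 * C * m ^ ρ' ≤ 3 * C * m ^ (ρ' - ρ) * T ^ ρ := by
    have hsplit : m ^ ρ' = m ^ (ρ' - ρ) * m ^ ρ := by rw [← Real.rpow_add hm0]; congr 1; ring
    rw [hsplit, ← mul_assoc]
    have := Real.rpow_nonneg hm0.le (ρ' - ρ)
    gcongr
  have hshiftT : κ * (ρ * (c / T)) ≤ κ₀ * ρ * c * m ^ (-1 : ℝ) := by
    rw [Real.rpow_neg_one, mul_assoc κ₀, mul_assoc κ₀, mul_assoc ρ, ← div_eq_mul_inv]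
    gcongr
  have hκT := mul_le_mul_of_nonneg_right
    (show κ' + κ * (ρ * (c / T)) + 3 * C * m ^ (ρ' - ρ) ≤ κ by linarith)
    (Real.rpow_nonneg hT0.le ρ)
  have hκb := mul_le_mul_of_nonneg_left
    ((rpow_mul_one_sub_le_sub_rpow hρ hT0 (hcm.trans hmT)).trans hTb) hκ
  rw [logDecay, logDecay, ← Real.exp_nat_mul, ← Real.exp_add, ← Real.exp_add, Real.exp_le_exp]
  push_cast
  linarith

theorem eventually_sq_card_cube_mul_inv_gapThreshold_le (d : ℕ) {ρ' : ℝ} (hρ' : 1 < ρ') :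
    ∀ᶠ l : ℝ in atTop, ∀ (L : ℝ) (x : Lattice d), 1 ≤ L → L ≤ l ^ (2 : ℝ) →
      ((cube x L).card : ℝ) ^ 2 * (gapThreshold ρ' L)⁻¹ ≤
        Real.exp ((2 ^ ρ' + 1) * (Real.log l) ^ ρ') := by
  filter_upwards [eventually_ge_atTop 1, eventually_mul_rpow_le_exp_mul_log_rpow
    ((3 : ℝ) ^ (2 * d)) ((4 * d : ℕ) : ℝ) one_pos hρ'] with l hl hvol L x hL hLl
  rw [one_mul] at hvol
  have hcard : ((cube x L).card : ℝ) ^ 2 ≤ Real.exp ((Real.log l) ^ ρ') :=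
    calc ((cube x L).card : ℝ) ^ 2 ≤ ((3 * l ^ 2) ^ d) ^ 2 := by
          refine pow_le_pow_left₀ (Nat.cast_nonneg _) ((card_cube_le x hL).trans ?_) 2
          rw [← Real.rpow_two]
          gcongr
      _ = (3 : ℝ) ^ (2 * d) * l ^ ((4 * d : ℕ) : ℝ) := by rw [Real.rpow_natCast]; ring
      _ ≤ Real.exp ((Real.log l) ^ ρ') := hvol
  have hlog : (Real.log L) ^ ρ' ≤ 2 ^ ρ' * (Real.log l) ^ ρ' := by
    rw [← Real.mul_rpow (by norm_num) (Real.log_nonneg hl)]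
    exact Real.rpow_le_rpow (Real.log_nonneg hL)
      ((Real.le_rpow_iff_log_le (by linarith) (by linarith)).1 hLl) (by linarith)
  calc ((cube x L).card : ℝ) ^ 2 * (gapThreshold ρ' L)⁻¹
      ≤ Real.exp ((Real.log l) ^ ρ') * Real.exp (2 ^ ρ' * (Real.log l) ^ ρ') := by
        rw [gapThreshold, ← Real.exp_neg, neg_neg]
        gcongr
    _ = _ := by rw [← Real.exp_add]; congr 1; ring

theorem gapThreshold_anti {ρ' l L : ℝ} (hρ' : 0 ≤ ρ') (hl : 1 ≤ l) (hlL : l ≤ L) :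
    gapThreshold ρ' L ≤ gapThreshold ρ' l :=
  Real.exp_le_exp.2 (neg_le_neg (Real.rpow_le_rpow (Real.log_nonneg hl)
    (Real.log_le_log (by linarith) hlL) hρ'))

theorem eventually_scale_separation {a : ℝ} (ha : 5 / 4 < a) :
    ∀ᶠ l : ℝ in atTop, ∀ L : ℝ, l ^ a ≤ L →
      l ≤ L ∧ 200 * l ≤ L ^ (4 / 5 : ℝ) ∧ 5 / 4 * Real.log l ≤ Real.log L := by
  filter_upwards [eventually_ge_atTop 1,
    eventually_mul_rpow_le_mul_rpow (a := 1) (b := a * (4 / 5)) (by linarith) 200 one_pos]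
    with l hl h200 L hlL
  have hl0 : 0 < l := by linarith
  have hlL' : l ≤ L := (Real.self_le_rpow_of_one_le hl (by linarith)).trans hlL
  refine ⟨hlL', ?_, ?_⟩
  · rw [Real.rpow_one, one_mul, Real.rpow_mul hl0.le] at h200
    exact h200.trans (Real.rpow_le_rpow (Real.rpow_nonneg hl0.le _) hlL (by norm_num))
  · exact (mul_le_mul_of_nonneg_right ha.le (Real.log_nonneg hl)).trans
      ((Real.rpow_le_iff_le_log hl0 (by linarith)).1 hlL)

theorem eventually_good_of_not_resonant (d : ℕ) {ρ ρ' κ₀ κinf σ a : ℝ} (hρ' : 1 < ρ')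
    (hρ'ρ : ρ' < ρ) (hκinf : 0 < κinf) (hκ : κinf < κ₀) (hσ0 : 0 < σ) (hσ1 : σ < 1)
    (hσρ : σ < ρ - ρ') (ha : 5 / 4 < a) :
    ∀ᶠ l : ℝ in atTop, ∀ L : ℝ, l ^ a ≤ L → L ≤ l ^ (2 : ℝ) →
      ∀ (H : Matrix (Lattice d) (Lattice d) ℂ) (E : ℝ) (x : Lattice d),
      H.IsHermitian → OffDiagDecay H κ₀ ρ → ¬Resonant H E (gapThreshold ρ' L) l L x →
      ¬HasFourSeparated (fun z => Bad H ρ ρ' (rate κ₀ κinf σ l) E z l) (2 * l) (cube x L) →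
      Good H ρ ρ' (rate κ₀ κinf σ L) E x L := by
  have hρ : 1 ≤ ρ := by linarith
  obtain ⟨N, hN⟩ : ∃ N : ℕ, 4 * ((3 : ℝ) ^ ρ + 1) ≤ (N : ℝ) := exists_nat_ge _
  have hN1 : (1 : ℝ) ≤ N := by linarith [Real.rpow_nonneg zero_le_three ρ]
  have hdrop : 0 < (κ₀ - κinf) * (1 - (5 / 4 : ℝ) ^ (-σ)) := mul_pos (sub_pos.2 hκ)
    (sub_pos.2 (Real.rpow_lt_one_of_one_lt_of_neg (by norm_num) (by linarith)))
  filter_upwards [eventually_ge_atTop 2, Real.tendsto_log_atTop.eventually (eventually_ge_atTop 1),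
    eventually_mul_rpow_le_mul_rpow (a := 4 / 5) (b := 1) (by norm_num) 1 (half_pos one_pos),
    eventually_scale_separation ha, eventually_sq_card_cube_mul_inv_gapThreshold_le d hρ',
    eventually_short_hop_le hρ hρ'ρ hκinf (2 ^ ρ' + 1),
    eventually_iterated_hop_le hρ hρ'ρ hκinf (2 ^ ρ' + 1) hN,
    eventually_long_hop_le hρ (hκinf.trans hκ).le hσ1 hσρ (C := 2 ^ ρ' + 1) (by positivity) hdrop
      (336 * N) (by linarith)]
    with l hl hlog hl45 hsep hvol hshort hiter hlong L hlL hLl H E x hH hoff hres hbad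
  rw [Real.rpow_one] at hl45
  have hl0 : 0 < l := by linarith
  obtain ⟨hlL', h200, hlogL⟩ := hsep L hlL
  have hgap := rate_add_gap_le hκ.le hσ0.le (by linarith) hlogL
  have hκl : κinf ≤ rate κ₀ κinf σ l := le_rate hκ.le (by linarith)
  have hκl₀ : rate κ₀ κinf σ l ≤ κ₀ := rate_le hκ.le hσ0.le hlog
  have hdecr : rate κ₀ κinf σ L ≤ rate κ₀ κinf σ l := le_trans
    (le_add_of_nonneg_right (mul_nonneg hdrop.le (Real.rpow_nonneg (by linarith) _))) hgap
  refine ⟨(nonResonant_iff_hasGap hH (by linarith)).2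
    (hasGap_of_not_resonant hres (cube_mem_subregions l L x)), fun hx y hy hxy => ?_⟩
  rw [← greenExt_of_mem hx hy, norm_sub_rev x y]
  have hyL : ‖y - x‖ ≤ L := mem_cube.1 hy
  rcases greenExt_decay_alternative hH (hoff.mono hκl₀) (by linarith) (by linarith) hl
    (by linarith) (gapThreshold_pos _ _) (gapThreshold_anti (by linarith) (by linarith) hlL')
    (hvol L x (by linarith) hLl) ((hshort _ hκl).trans (Real.exp_le_one_iff.2 (neg_nonpos.2
      (mul_nonneg (by linarith) (Real.rpow_nonneg (by linarith) _))))) hres hbad hy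
    (by linarith) N with h | ⟨b, hlb, hyb, h⟩
  · refine h.trans (hiter _ _ _ hκl hdecr (by linarith) ?_)
    have hcube : l ^ (3 : ℝ) = l ^ (2 : ℝ) * l := by
      rw [← Real.rpow_add_one hl0.ne']; norm_num
    rw [hcube]
    have := mul_le_mul_of_nonneg_left hl (Real.rpow_nonneg hl0.le 2)
    linarith
  · refine h.trans (hlong _ _ _ _ (hκinf.le.trans hκl) hκl₀ hgap (by linarith) ?_)
    have := mul_le_mul hN1 hlb hl0.le (by linarith)
    linarith

end LargeScale

/-! ### Product measures and Hölder continuous measures -/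

section Product

variable {ι : Type*} {X : ι → Type*} [∀ i, MeasurableSpace (X i)] (μ : ∀ i, Measure (X i))
  [∀ i, IsProbabilityMeasure (μ i)]

theorem map_update_prod_infinitePi [DecidableEq ι] (i : ι) :
    ((Measure.infinitePi μ).prod (μ i)).map (fun p => Function.update p.1 i p.2) =
      Measure.infinitePi μ := by
  refine Measure.eq_infinitePi μ fun S t ht => ?_
  have hpre : (fun p : (∀ j, X j) × X i => Function.update p.1 i p.2) ⁻¹' Set.pi S t =
      Set.pi (S.erase i : Finset ι) t ×ˢ {a | i ∈ S → a ∈ t i} := by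
    ext ⟨v, a⟩
    simp only [Set.mem_preimage, Set.mem_pi, Finset.mem_coe, Set.mem_prod, Finset.mem_erase,
      Set.mem_ofPred_eq]
    refine ⟨fun h => ⟨fun j hj => ?_, fun hi => ?_⟩, fun h j hj => ?_⟩
    · simpa [hj.1] using h j hj.2
    · simpa using h i hi
    · rcases eq_or_ne j i with rfl | hji
      · simpa using h.2 hj
      · simpa [hji] using h.1 j ⟨hji, hj⟩
  rw [Measure.map_apply measurable_update' (.pi S.countable_toSet fun j _ => ht j), hpre,
    Measure.prod_prod, Measure.infinitePi_pi μ fun j _ => ht j]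
  by_cases hi : i ∈ S
  · simp [hi, Finset.prod_erase_mul]
  · simp [hi]

/-- Fubini in the direction of the coordinate `i`, which is resampled independently of all the
others. -/
theorem infinitePi_le_of_forall_update_le [DecidableEq ι] {U : Set (∀ i, X i)}
    (hU : MeasurableSet U) {i : ι} {s : ℝ≥0∞} (hs : ∀ v, μ i {a | Function.update v i a ∈ U} ≤ s) :
    Measure.infinitePi μ U ≤ s := by
  have hm : MeasurableSet ((fun p : (∀ j, X j) × X i => Function.update p.1 i p.2) ⁻¹' U) :=
    measurable_update' hU
  rw [← map_update_prod_infinitePi μ i, Measure.map_apply measurable_update' hU,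
    Measure.prod_apply hm]
  exact (lintegral_mono hs).trans (by simp)

theorem infinitePi_inter_eq_mul_of_dependsOn {S S' : Finset ι} (hSS' : Disjoint S S')
    {U U' : Set (∀ i, X i)} (hU : MeasurableSet U) (hU' : MeasurableSet U')
    (hS : DependsOn (· ∈ U) (S : Set ι)) (hS' : DependsOn (· ∈ U') (S' : Set ι)) :
    Measure.infinitePi μ (U ∩ U') = Measure.infinitePi μ U * Measure.infinitePi μ U' := by
  classical
  obtain ⟨v₀⟩ : Nonempty (∀ i, X i) := ⟨fun i => (nonempty_of_isProbabilityMeasure (μ i)).some⟩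
  have hext : ∀ (T : Finset ι) (W : Set (∀ i, X i)), DependsOn (· ∈ W) (T : Set ι) →
      T.restrict ⁻¹' (Function.updateFinset v₀ T ⁻¹' W) = W := fun T W hT => by
    ext v
    refine iff_of_eq (hT fun i hi => ?_)
    simp [Function.updateFinset, Finset.mem_coe.1 hi]
  have hindep := (iIndepFun_infinitePi (P := μ) (X := fun _ a => a) fun _ =>
    measurable_id).indepFun_finset S S' hSS' fun i => measurable_pi_apply i
  have h := hindep.measure_inter_preimage_eq_mul _ _
    (measurable_updateFinset (x := v₀) hU) (measurable_updateFinset (x := v₀) hU')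
  rwa [show (fun (a : ∀ i, X i) (i : S) => a i) = S.restrict from rfl,
    show (fun (a : ∀ i, X i) (i : S') => a i) = S'.restrict from rfl, hext S U hS,
    hext S' U' hS'] at h

end Product

theorem IsHolder.exists_measure_Icc_le {lam : ℝ} {μ : Measure ℝ} (h : IsHolder lam μ) :
    ∃ C t : ℝ, 0 < t ∧ ∀ a r : ℝ, 0 < r → r ≤ t →
      μ (Set.Icc a (a + r)) ≤ ENNReal.ofReal (C * r ^ lam) := by
  obtain ⟨C, hC, -⟩ := ENNReal.lt_iff_exists_nnreal_btwn.1 h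
  simp only [holderCoeff, iInf_lt_iff] at hC
  obtain ⟨t, ht, hC⟩ := hC
  refine ⟨C, t, ht, fun a r hr hrt => ?_⟩
  have habs : |a + r - a| = r := by rw [add_sub_cancel_left, abs_of_pos hr]
  have hle : μ (Set.Icc a (a + r)) * ENNReal.ofReal (r ^ (-lam)) ≤ C := by
    refine le_trans ?_ hC.le
    refine le_iSup_of_le a (le_iSup_of_le (a + r) (le_iSup_of_le ?_ ?_))
    · rw [habs]; exact ⟨hr, hrt⟩
    · rw [habs]
  have hpos : 0 < r ^ lam := Real.rpow_pos_of_pos hr _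
  rw [Real.rpow_neg hr.le, ENNReal.ofReal_inv_of_pos hpos, ← div_eq_mul_inv,
    ENNReal.div_le_iff (by simpa using hpos) ENNReal.ofReal_ne_top] at hle
  rwa [ENNReal.ofReal_mul C.coe_nonneg, ENNReal.ofReal_coe_nnreal]

theorem measure_le_of_forall_abs_sub_le {μ : Measure ℝ} {r : ℝ} {s : ℝ≥0∞}
    (hμ : ∀ a, μ (Set.Icc a (a + r)) ≤ s) {T : Set ℝ}
    (hT : ∀ v ∈ T, ∀ v' ∈ T, |v - v'| ≤ r) : μ T ≤ s := by
  rcases T.eq_empty_or_nonempty with rfl | ⟨v₀, hv₀⟩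
  · simp
  have hbdd : BddBelow T := ⟨v₀ - r, fun v hv => by
    linarith [(abs_le.1 (hT v hv v₀ hv₀)).1]⟩
  refine (measure_mono fun v hv => ?_).trans (hμ (sInf T))
  have hle : v - r ≤ sInf T := le_csInf ⟨v₀, hv₀⟩ fun v' hv' => by
    linarith [(abs_le.1 (hT v hv v' hv')).2]
  exact ⟨csInf_le hbdd hv, by linarith⟩

theorem measure_setOf_approxKernelAt_le {μ : Measure ℝ} {r : ℝ} {s : ℝ≥0∞}
    (hμ : ∀ a, μ (Set.Icc a (a + r)) ≤ s) {n : Type*} [Fintype n] [DecidableEq n]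
    {A : Matrix n n ℂ} (hA : A.IsHermitian) {η : ℝ} (hη : 2 * η * Fintype.card n ≤ r) (i : n) :
    μ {a | ApproxKernelAt (A + single i i (a : ℂ)) η i} ≤ s := by
  refine measure_le_of_forall_abs_sub_le hμ fun a ha a' ha' => ?_
  refine (abs_le_of_approxKernelAt (hA.add ?_) ?_ ha ha').trans hη
  · simp [IsHermitian, conjTranspose_single]
  · ext p q
    simp [single_apply, ite_sub_ite]

/-! ### Random potentials -/

section Potential

variable {d : ℕ} {φ : Lattice d → ℂ} {ε δ E ρ ρ' κ κ' L : ℝ} {B Λ : Finset (Lattice d)}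
  {v v' : Lattice d → ℝ} {x y : Lattice d} {I : Set ℝ}

/-- The law on `ℝ ^ ℤ^d` of a family of i.i.d. random variables with common distribution `μ`. -/
noncomputable abbrev potentialLaw (d : ℕ) (μ : Measure ℝ) : Measure (Lattice d → ℝ) :=
  Measure.infinitePi fun _ => μ

/-- The potentials for which `B_L(x)` and `B_L(y)` are `(κ, E)`-bad at a common energy `E ∈ I`. -/
def badPair (ε : ℝ) (φ : Lattice d → ℂ) (ρ ρ' κ L : ℝ) (I : Set ℝ) (x y : Lattice d) :
    Set (Lattice d → ℝ) :=
  {v | ∃ E ∈ I, Bad (hamiltonian ε φ v) ρ ρ' κ E x L ∧ Bad (hamiltonian ε φ v) ρ ρ' κ E y L}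

theorem isHermitian_hamiltonian (hsym : ∀ x, φ x = starRingEnd ℂ (φ (-x))) (ε : ℝ)
    (v : Lattice d → ℝ) : (hamiltonian ε φ v).IsHermitian := by
  ext x y
  have h : starRingEnd ℂ (φ (y - x)) = φ (x - y) := by rw [hsym (x - y), neg_sub]
  rcases eq_or_ne x y with rfl | hxy
  · rw [sub_self] at h
    simp [hamiltonian, h]
  · simp [hamiltonian, hxy, hxy.symm, h]

theorem offDiagDecay_hamiltonian (hφ : ∀ x, ‖φ x‖ ≤ logDecay κ ρ (‖x‖ + 1)) (hε : 0 ≤ ε)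
    (hε1 : ε ≤ 1) (v : Lattice d → ℝ) : OffDiagDecay (hamiltonian ε φ v) κ ρ := by
  intro x y hxy
  have h : ‖hamiltonian ε φ v x y‖ = ε * ‖φ (x - y)‖ := by
    simp [hamiltonian, hxy, abs_of_nonneg hε]
  rw [h]
  exact (mul_le_of_le_one_left (norm_nonneg _) hε1).trans (hφ _)

theorem restrict_hamiltonian_congr (h : ∀ z ∈ B, v z = v' z) :
    restrict (hamiltonian ε φ v) B = restrict (hamiltonian ε φ v') B := by
  ext a b
  simp [restrict, hamiltonian, h a a.2]

theorem restrict_hamiltonian_update (i : B) (a : ℝ) :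
    restrict (hamiltonian ε φ (Function.update v i a)) B =
      restrict (hamiltonian ε φ (Function.update v i 0)) B + single i i (a : ℂ) := by
  ext p q
  rcases eq_or_ne p i with rfl | hp
  · rcases eq_or_ne p q with rfl | hq
    · simp [restrict, hamiltonian]
    · simp [restrict, hamiltonian, hq, Subtype.coe_ne_coe.2 hq]
  · simp [restrict, hamiltonian, hp.symm, Function.update_of_ne (Subtype.coe_ne_coe.2 hp)]

theorem continuous_restrict_hamiltonian_sub (ε : ℝ) (φ : Lattice d → ℂ) (B : Finset (Lattice d))
    (E : ℝ) : Continuous fun v : Lattice d → ℝ =>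
      restrict (hamiltonian ε φ v) B - (E : ℂ) • (1 : Matrix B B ℂ) := by
  refine Continuous.sub (continuous_matrix fun a b => ?_) continuous_const
  simp only [restrict, hamiltonian, submatrix_apply, of_apply]
  split_ifs <;> fun_prop

theorem hasGap_hamiltonian_congr (h : ∀ z ∈ B, v z = v' z) :
    HasGap (hamiltonian ε φ v) E δ B ↔ HasGap (hamiltonian ε φ v') E δ B := by
  simp only [HasGap, restrict_hamiltonian_congr h]

theorem isClosed_setOf_hasGap (ε : ℝ) (φ : Lattice d → ℂ) (δ E : ℝ) (B : Finset (Lattice d)) :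
    IsClosed {v : Lattice d → ℝ | HasGap (hamiltonian ε φ v) E δ B} :=
  (isClosed_setOf_boundedBelow δ).preimage (continuous_restrict_hamiltonian_sub ε φ B E)

/-- Multiplying the condition on the Green's function by the determinant turns it into a closed
condition on all matrices. -/
theorem isClosed_setOf_good (hsym : ∀ x, φ x = starRingEnd ℂ (φ (-x))) (ε ρ ρ' κ E : ℝ)
    (x : Lattice d) (hL : 0 ≤ L) :
    IsClosed {v : Lattice d → ℝ | Good (hamiltonian ε φ v) ρ ρ' κ E x L} := by
  let M : (Lattice d → ℝ) → Matrix (cube x L) (cube x L) ℂ := fun v =>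
    restrict (hamiltonian ε φ v) (cube x L) - (E : ℂ) • (1 : Matrix (cube x L) (cube x L) ℂ)
  have hM : Continuous M := continuous_restrict_hamiltonian_sub ε φ (cube x L) E
  have heq : {v : Lattice d → ℝ | Good (hamiltonian ε φ v) ρ ρ' κ E x L} =
      {v | HasGap (hamiltonian ε φ v) E (gapThreshold ρ' L) (cube x L)} ∩
      ⋂ (y : cube x L) (_ : L ^ (4 / 5 : ℝ) < ‖(y : Lattice d) - x‖),
        {v | ‖(M v).adjugate ⟨x, self_mem_cube x hL⟩ y‖ ≤
          ‖(M v).det‖ * logDecay κ ρ (‖x - (y : Lattice d)‖ + 1)} := by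
    ext v
    simp only [Set.mem_ofPred_eq, Set.mem_inter_iff, Set.mem_iInter, Good,
      nonResonant_iff_hasGap (isHermitian_hamiltonian hsym ε v) hL]
    refine and_congr_right fun hgap => ?_
    have hdet : 0 < ‖(M v).det‖ :=
      norm_pos_iff.2 (isUnit_iff_ne_zero.1 (hgap.isUnit_det (gapThreshold_pos ρ' L)))
    have hgreen : ∀ a b, ‖green (hamiltonian ε φ v) (cube x L) E a b‖ =
        ‖(M v).adjugate a b‖ / ‖(M v).det‖ := by
      intro a b
      rw [green, Matrix.inv_def, Matrix.smul_apply, smul_eq_mul, norm_mul, Ring.inverse_eq_inv',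
        norm_inv, inv_mul_eq_div]
    simp only [hgreen, div_le_iff₀' hdet, logDecay]
    exact ⟨fun h y hy => h _ y y.2 hy, fun h _ y hy hyx => h ⟨y, hy⟩ hyx⟩
  rw [heq]
  exact (isClosed_setOf_hasGap ε φ _ E _).inter <| isClosed_iInter fun y => isClosed_iInter fun _ =>
    isClosed_le (hM.matrix_adjugate.matrix_elem _ _).norm (hM.matrix_det.norm.mul continuous_const)

theorem isOpen_badPair (hsym : ∀ x, φ x = starRingEnd ℂ (φ (-x))) (ε ρ ρ' κ : ℝ) (hL : 0 ≤ L)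
    (I : Set ℝ) (x y : Lattice d) : IsOpen (badPair ε φ ρ ρ' κ L I x y) := by
  have heq : badPair ε φ ρ ρ' κ L I x y = ⋃ E ∈ I,
      {v | Good (hamiltonian ε φ v) ρ ρ' κ E x L}ᶜ ∩
        {v | Good (hamiltonian ε φ v) ρ ρ' κ E y L}ᶜ := by
    ext v
    simp only [badPair, Bad, Set.mem_ofPred_eq, Set.mem_iUnion, Set.mem_inter_iff,
      Set.mem_compl_iff, exists_prop]
  rw [heq]
  exact isOpen_biUnion fun E _ => (isClosed_setOf_good hsym ε ρ ρ' κ E x hL).isOpen_compl.inter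
    (isClosed_setOf_good hsym ε ρ ρ' κ E y hL).isOpen_compl

theorem dependsOn_badPair (ε : ℝ) (φ : Lattice d → ℂ) (ρ ρ' κ L : ℝ) (I : Set ℝ)
    (x y : Lattice d) :
    DependsOn (· ∈ badPair ε φ ρ ρ' κ L I x y) ((cube x L ∪ cube y L : Finset (Lattice d)) :
      Set (Lattice d)) := by
  intro v v' h
  have hx : restrict (hamiltonian ε φ v) (cube x L) = restrict (hamiltonian ε φ v') (cube x L) :=
    restrict_hamiltonian_congr fun z hz => h z (Finset.mem_union_left _ hz)
  have hy : restrict (hamiltonian ε φ v) (cube y L) = restrict (hamiltonian ε φ v') (cube y L) :=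
    restrict_hamiltonian_congr fun z hz => h z (Finset.mem_union_right _ hz)
  simp only [badPair, Set.mem_ofPred_eq, Bad, Good, NonResonant, green, hx, hy]

theorem badPair_mono (h : κ ≤ κ') :
    badPair ε φ ρ ρ' κ L I x y ⊆ badPair ε φ ρ ρ' κ' L I x y := by
  rintro v ⟨E, hE, hx, hy⟩
  exact ⟨E, hE, fun hg => hx (hg.mono h), fun hg => hy (hg.mono h)⟩

end Potential

/-! ### Probability estimates -/

section Wegner

variable {d : ℕ} {φ : Lattice d → ℂ} {δ l L r : ℝ} {Λ Λ' : Finset (Lattice d)}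
  {μ : Measure ℝ} [IsProbabilityMeasure μ] {s : ℝ≥0∞}

/-- Resampling the potential at `i ∈ Λ` leaves the at most `#Λ'` resonant energies of `Λ'`
unchanged. -/
theorem potentialLaw_approxKernelAt_and_not_hasGap_le
    (hsym : ∀ x, φ x = starRingEnd ℂ (φ (-x))) (ε : ℝ) (hΛ : Disjoint Λ Λ') (hδ : 0 < δ)
    (hr : 4 * δ * Λ.card ≤ r) (hs : ∀ a, μ (Set.Icc a (a + r)) ≤ s) (i : Λ) :
    potentialLaw d μ {v | ∃ E : ℝ,
      ApproxKernelAt (restrict (hamiltonian ε φ v) Λ - (E : ℂ) • (1 : Matrix Λ Λ ℂ)) δ i ∧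
        ¬HasGap (hamiltonian ε φ v) E δ Λ'} ≤ Λ'.card * s := by
  have hopen : IsOpen {v : Lattice d → ℝ | ∃ E : ℝ,
      ApproxKernelAt (restrict (hamiltonian ε φ v) Λ - (E : ℂ) • (1 : Matrix Λ Λ ℂ)) δ i ∧
        ¬HasGap (hamiltonian ε φ v) E δ Λ'} := by
    rw [Set.ofPred_exists]
    exact isOpen_iUnion fun E => ((isOpen_setOf_approxKernelAt δ i).preimage
      (continuous_restrict_hamiltonian_sub ε φ Λ E)).inter
        (isClosed_setOf_hasGap ε φ δ E Λ').isOpen_compl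
  refine infinitePi_le_of_forall_update_le _ hopen.measurableSet (i := i) fun v => ?_
  have hH := isHermitian_hamiltonian hsym ε
  let e : Λ' → ℝ := (restrict_isHermitian (hH v) Λ').eigenvalues
  let A : Λ' → Matrix Λ Λ ℂ := fun k =>
    restrict (hamiltonian ε φ (Function.update v i 0)) Λ - (e k : ℂ) • (1 : Matrix Λ Λ ℂ)
  have hcover : {a : ℝ | Function.update v i a ∈ {v : Lattice d → ℝ | ∃ E : ℝ,
      ApproxKernelAt (restrict (hamiltonian ε φ v) Λ - (E : ℂ) • (1 : Matrix Λ Λ ℂ)) δ i ∧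
        ¬HasGap (hamiltonian ε φ v) E δ Λ'}} ⊆
      ⋃ k, {a : ℝ | ApproxKernelAt (A k + single i i (a : ℂ)) (2 * δ) i} := by
    rintro a ⟨E, hΛE, hgap⟩
    rw [hasGap_hamiltonian_congr (v' := v) fun z hz => Function.update_of_ne
      (ne_of_mem_of_not_mem hz (Finset.disjoint_left.1 hΛ i.2)) _ _] at hgap
    obtain ⟨k, hk⟩ : ∃ k, |e k - E| < δ := by
      contrapose! hgap
      exact boundedBelow_sub_of_eigenvalues (restrict_isHermitian (hH v) Λ') hδ.le hgap
    refine Set.mem_iUnion.2 ⟨k, ?_⟩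
    have h := hΛE.shift_energy hk.le
    rwa [restrict_hamiltonian_update, add_sub_right_comm] at h
  refine (measure_mono hcover).trans ((measure_iUnion_fintype_le _ _).trans ?_)
  have hterm : ∀ k, μ {a | ApproxKernelAt (A k + single i i (a : ℂ)) (2 * δ) i} ≤ s := fun k =>
    measure_setOf_approxKernelAt_le hs
      (isHermitian_sub_smul_one (restrict_isHermitian (hH _) Λ) _)
      (by rw [Fintype.card_coe]; linarith) i
  exact (Finset.sum_le_card_nsmul _ _ _ fun k _ => hterm k).trans (by simp)

theorem potentialLaw_not_hasGap_and_not_hasGap_le (hsym : ∀ x, φ x = starRingEnd ℂ (φ (-x)))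
    (ε : ℝ) (hΛ : Disjoint Λ Λ') (hδ : 0 < δ) (hr : 4 * δ * Λ.card ≤ r)
    (hs : ∀ a, μ (Set.Icc a (a + r)) ≤ s) :
    potentialLaw d μ {v | ∃ E, ¬HasGap (hamiltonian ε φ v) E δ Λ ∧
      ¬HasGap (hamiltonian ε φ v) E δ Λ'} ≤ Λ.card * (Λ'.card * s) := by
  have hcover : {v : Lattice d → ℝ | ∃ E, ¬HasGap (hamiltonian ε φ v) E δ Λ ∧
      ¬HasGap (hamiltonian ε φ v) E δ Λ'} ⊆ ⋃ i : Λ, {v | ∃ E : ℝ,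
        ApproxKernelAt (restrict (hamiltonian ε φ v) Λ - (E : ℂ) • (1 : Matrix Λ Λ ℂ)) δ i ∧
          ¬HasGap (hamiltonian ε φ v) E δ Λ'} := by
    rintro v ⟨E, hgap, hgap'⟩
    obtain ⟨i, hi⟩ := exists_approxKernelAt hgap
    exact Set.mem_iUnion.2 ⟨i, E, hi, hgap'⟩
  refine (measure_mono hcover).trans ((measure_iUnion_fintype_le _ _).trans ?_)
  refine (Finset.sum_le_card_nsmul _ _ _ fun i _ =>
    potentialLaw_approxKernelAt_and_not_hasGap_le hsym ε hΛ hδ hr hs i).trans ?_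
  simp

end Wegner

section Scales

variable {d : ℕ} {φ : Lattice d → ℂ} {ε δ κ κ' ρ ρ' l L : ℝ} {I : Set ℝ} {x y : Lattice d}
  {μ : Measure ℝ} [IsProbabilityMeasure μ] {q s : ℝ≥0∞}

theorem disjoint_cube (h : 2 * L < ‖x - y‖) : Disjoint (cube x L) (cube y L) := by
  refine Finset.disjoint_left.2 fun z hx hy => ?_
  rw [mem_cube] at hx hy
  linarith [norm_sub_le_norm_sub_add_norm_sub x z y, norm_sub_rev x z]

theorem natCast_card_le_ofReal {Λ : Finset (Lattice d)} (hL : 1 ≤ L) (hΛ : Λ ⊆ cube x L) :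
    (Λ.card : ℝ≥0∞) ≤ ENNReal.ofReal ((3 * L) ^ d) := by
  rw [← ENNReal.ofReal_natCast]
  exact ENNReal.ofReal_le_ofReal
    ((Nat.cast_le.2 (Finset.card_le_card hΛ)).trans (card_cube_le x hL))

theorem potentialLaw_resonant_and_resonant_le (hsym : ∀ x, φ x = starRingEnd ℂ (φ (-x))) (ε : ℝ)
    (hδ : 0 < δ) (l : ℝ) (hL : 1 ≤ L) (hs : ∀ a, μ (Set.Icc a (a + 4 * δ * (3 * L) ^ d)) ≤ s)
    (hxy : 2 * L < ‖x - y‖) :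
    potentialLaw d μ {v | ∃ E, Resonant (hamiltonian ε φ v) E δ l L x ∧
      Resonant (hamiltonian ε φ v) E δ l L y} ≤ 25 * (ENNReal.ofReal ((3 * L) ^ d) ^ 4 * s) := by
  set N := ENNReal.ofReal ((3 * L) ^ d)
  have hcard : ∀ x : Lattice d, ((subregions l L x).card : ℝ≥0∞) ≤ 5 * N := fun x =>
    calc ((subregions l L x).card : ℝ≥0∞) ≤ ((5 * (cube x L).card : ℕ) : ℝ≥0∞) :=
          Nat.cast_le.2 (card_subregions_le l (by linarith) x)
      _ = 5 * ((cube x L).card : ℝ≥0∞) := by push_cast; rfl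
      _ ≤ 5 * N := by gcongr; exact natCast_card_le_ofReal hL subset_rfl
  have hcover : {v : Lattice d → ℝ | ∃ E, Resonant (hamiltonian ε φ v) E δ l L x ∧
      Resonant (hamiltonian ε φ v) E δ l L y} ⊆ ⋃ Λ ∈ subregions l L x ×ˢ subregions l L y,
        {v | ∃ E, ¬HasGap (hamiltonian ε φ v) E δ Λ.1 ∧
          ¬HasGap (hamiltonian ε φ v) E δ Λ.2} := by
    rintro v ⟨E, ⟨Λ, hΛ, hgap⟩, Λ', hΛ', hgap'⟩
    exact Set.mem_biUnion (x := (Λ, Λ')) (Finset.mem_product.2 ⟨hΛ, hΛ'⟩) ⟨E, hgap, hgap'⟩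
  have hterm : ∀ Λ ∈ subregions l L x ×ˢ subregions l L y,
      potentialLaw d μ {v | ∃ E, ¬HasGap (hamiltonian ε φ v) E δ Λ.1 ∧
        ¬HasGap (hamiltonian ε φ v) E δ Λ.2} ≤ N * (N * s) := by
    intro Λ hΛ
    obtain ⟨h1, h2⟩ := Finset.mem_product.1 hΛ
    have h1' := subset_of_mem_subregions h1
    have h2' := subset_of_mem_subregions h2
    have hr : 4 * δ * Λ.1.card ≤ 4 * δ * (3 * L) ^ d := by
      gcongr
      exact (Nat.cast_le.2 (Finset.card_le_card h1')).trans (card_cube_le x hL)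
    refine (potentialLaw_not_hasGap_and_not_hasGap_le hsym ε ((disjoint_cube hxy).mono h1' h2') hδ
      hr hs).trans ?_
    gcongr
    exacts [natCast_card_le_ofReal hL h1', natCast_card_le_ofReal hL h2']
  calc _ ≤ ∑ _Λ ∈ subregions l L x ×ˢ subregions l L y, N * (N * s) :=
        (measure_mono hcover).trans ((measure_biUnion_finset_le _ _).trans
          (Finset.sum_le_sum hterm))
    _ = (subregions l L x).card * (subregions l L y).card * (N * (N * s)) := by
        rw [Finset.sum_const, nsmul_eq_mul, Finset.card_product, Nat.cast_mul]
    _ ≤ 5 * N * (5 * N) * (N * (N * s)) := by gcongr <;> exact hcard _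
    _ = 25 * (N ^ 4 * s) := by ring

/-- Each of the two pairs `z 0, z 1` and `z 2, z 3` of separated bad cubes costs a factor `q`, and
by independence both together cost `q * q`. -/
theorem potentialLaw_hasFourSeparated_bad_le (hsym : ∀ x, φ x = starRingEnd ℂ (φ (-x)))
    (hl : 0 ≤ l) (hL : 1 ≤ L)
    (hq : ∀ x y, 2 * l < ‖x - y‖ → potentialLaw d μ (badPair ε φ ρ ρ' κ l I x y) ≤ q)
    (x : Lattice d) :
    potentialLaw d μ {v | ∃ E ∈ I,
      HasFourSeparated (fun z => Bad (hamiltonian ε φ v) ρ ρ' κ E z l) (2 * l) (cube x L)} ≤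
      ENNReal.ofReal ((3 * L) ^ d) ^ 4 * (q * q) := by
  classical
  let b : Lattice d → Lattice d → Set (Lattice d → ℝ) := badPair ε φ ρ ρ' κ l I
  let Z : Finset (Fin 4 → Lattice d) := {z ∈ Fintype.piFinset fun _ => cube x L |
    Pairwise fun i j => 2 * l < ‖z i - z j‖}
  have hcover : {v : Lattice d → ℝ | ∃ E ∈ I,
      HasFourSeparated (fun z => Bad (hamiltonian ε φ v) ρ ρ' κ E z l) (2 * l) (cube x L)} ⊆
      ⋃ z ∈ Z, b (z 0) (z 1) ∩ b (z 2) (z 3) := by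
    rintro v ⟨E, hE, z, hz, hsep, hbad⟩
    exact Set.mem_biUnion (x := z) (Finset.mem_filter.2 ⟨Fintype.mem_piFinset.2 hz, hsep⟩)
      ⟨⟨E, hE, hbad 0, hbad 1⟩, ⟨E, hE, hbad 2, hbad 3⟩⟩
  have hterm : ∀ z ∈ Z, potentialLaw d μ (b (z 0) (z 1) ∩ b (z 2) (z 3)) ≤ q * q := by
    intro z hz
    have hsep : ∀ i j, i ≠ j → 2 * l < ‖z i - z j‖ := fun i j h => (Finset.mem_filter.1 hz).2 h
    have hdisj : Disjoint (cube (z 0) l ∪ cube (z 1) l) (cube (z 2) l ∪ cube (z 3) l) := by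
      simp only [Finset.disjoint_union_left, Finset.disjoint_union_right]
      exact ⟨⟨disjoint_cube (hsep 0 2 (by decide)), disjoint_cube (hsep 1 2 (by decide))⟩,
        disjoint_cube (hsep 0 3 (by decide)), disjoint_cube (hsep 1 3 (by decide))⟩
    rw [infinitePi_inter_eq_mul_of_dependsOn _ hdisj
      (isOpen_badPair hsym ε ρ ρ' κ hl I _ _).measurableSet
      (isOpen_badPair hsym ε ρ ρ' κ hl I _ _).measurableSet
      (dependsOn_badPair ..) (dependsOn_badPair ..)]
    exact mul_le_mul' (hq _ _ (hsep 0 1 (by decide))) (hq _ _ (hsep 2 3 (by decide)))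
  have hZ : (Z.card : ℝ≥0∞) ≤ ENNReal.ofReal ((3 * L) ^ d) ^ 4 :=
    calc (Z.card : ℝ≥0∞) ≤ ((cube x L).card ^ 4 : ℕ) := by
          refine Nat.cast_le.2 ((Finset.card_filter_le _ _).trans_eq ?_)
          simp
      _ ≤ _ := by push_cast; gcongr; exact natCast_card_le_ofReal hL subset_rfl
  calc _ ≤ ∑ _z ∈ Z, q * q :=
        (measure_mono hcover).trans ((measure_biUnion_finset_le _ _).trans
          (Finset.sum_le_sum hterm))
    _ = Z.card * (q * q) := by rw [Finset.sum_const, nsmul_eq_mul]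
    _ ≤ _ := by gcongr

theorem potentialLaw_badPair_step_le (hsym : ∀ x, φ x = starRingEnd ℂ (φ (-x)))
    (hδ : 0 < δ) (hl : 0 ≤ l) (hL : 1 ≤ L)
    (hgood : ∀ E v x, ¬Resonant (hamiltonian ε φ v) E δ l L x →
      ¬HasFourSeparated (fun z => Bad (hamiltonian ε φ v) ρ ρ' κ E z l) (2 * l) (cube x L) →
      Good (hamiltonian ε φ v) ρ ρ' κ' E x L)
    (hs : ∀ a, μ (Set.Icc a (a + 4 * δ * (3 * L) ^ d)) ≤ s)
    (hq : ∀ x y, 2 * l < ‖x - y‖ → potentialLaw d μ (badPair ε φ ρ ρ' κ l I x y) ≤ q)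
    (hxy : 2 * L < ‖x - y‖) :
    potentialLaw d μ (badPair ε φ ρ ρ' κ' L I x y) ≤
      ENNReal.ofReal ((3 * L) ^ d) ^ 4 * (25 * s + 2 * (q * q)) := by
  let F : Lattice d → Set (Lattice d → ℝ) := fun x => {v | ∃ E ∈ I,
    HasFourSeparated (fun z => Bad (hamiltonian ε φ v) ρ ρ' κ E z l) (2 * l) (cube x L)}
  let R : Set (Lattice d → ℝ) := {v | ∃ E, Resonant (hamiltonian ε φ v) E δ l L x ∧
    Resonant (hamiltonian ε φ v) E δ l L y}
  have hcover : badPair ε φ ρ ρ' κ' L I x y ⊆ R ∪ (F x ∪ F y) := by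
    rintro v ⟨E, hE, hx, hy⟩
    by_contra! hv
    simp only [Set.mem_union, not_or] at hv
    refine hv.1 ⟨E, ?_, ?_⟩
    · exact of_not_not fun h => hx (hgood E v x h fun h4 => hv.2.1 ⟨E, hE, h4⟩)
    · exact of_not_not fun h => hy (hgood E v y h fun h4 => hv.2.2 ⟨E, hE, h4⟩)
  set N := ENNReal.ofReal ((3 * L) ^ d)
  have hF : ∀ x, potentialLaw d μ (F x) ≤ N ^ 4 * (q * q) :=
    potentialLaw_hasFourSeparated_bad_le hsym hl hL hq
  calc _ ≤ potentialLaw d μ R + (potentialLaw d μ (F x) + potentialLaw d μ (F y)) :=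
        (measure_mono hcover).trans ((measure_union_le _ _).trans
          (add_le_add le_rfl (measure_union_le _ _)))
    _ ≤ 25 * (N ^ 4 * s) + (N ^ 4 * (q * q) + N ^ 4 * (q * q)) := by
        gcongr
        exacts [potentialLaw_resonant_and_resonant_le hsym ε hδ l hL hs hxy, hF x, hF y]
    _ = _ := by ring

end Scales

/-! ### The initial scale -/

section LargeDiagonal

variable {d : ℕ} {H : Matrix (Lattice d) (Lattice d) ℂ} {B : Finset (Lattice d)}
  {E ε δ κ ρ ρ' L : ℝ} {x y : Lattice d}

theorem hasGap_of_large_diagonal (hH : H.IsHermitian) (hoff : ∀ u v, u ≠ v → ‖H u v‖ ≤ ε)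
    (hε : 0 ≤ ε) (hδ : 0 ≤ δ) (hεB : ε * B.card ≤ δ) (hdiag : ∀ u ∈ B, 2 * δ ≤ ‖H u u - E‖) :
    HasGap H E δ B := by
  refine boundedBelow_of_diagonally_dominant
    (isHermitian_sub_smul_one (restrict_isHermitian hH B) E) hδ fun u => ?_
  have hentry : ∀ v ∈ Finset.univ.erase u,
      ‖(restrict H B - (E : ℂ) • (1 : Matrix B B ℂ)) u v‖ ≤ ε := by
    intro v hv
    have huv : (u : Lattice d) ≠ v := fun h => Finset.ne_of_mem_erase hv (Subtype.ext h.symm)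
    rw [restrict_sub_smul_one_apply]
    simpa [one_apply_ne huv] using hoff u v huv
  have hrow : ∑ v ∈ Finset.univ.erase u,
      ‖(restrict H B - (E : ℂ) • (1 : Matrix B B ℂ)) u v‖ ≤ ε * B.card :=
    calc _ ≤ ∑ _v ∈ Finset.univ.erase u, ε := Finset.sum_le_sum hentry
      _ ≤ ∑ _v : B, ε := Finset.sum_le_sum_of_subset_of_nonneg (Finset.erase_subset _ _)
          fun _ _ _ => hε
      _ = ε * B.card := by simp [mul_comm]
  have huu : (restrict H B - (E : ℂ) • (1 : Matrix B B ℂ)) u u = H u u - E := by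
    rw [restrict_sub_smul_one_apply]
    simp
  rw [huu]
  linarith [hdiag u u.2]

theorem norm_greenExt_le_of_large_diagonal (hoff : ∀ u v, u ≠ v → ‖H u v‖ ≤ ε) (hε : 0 ≤ ε)
    (hδ : 0 < δ) (hgap : HasGap H E δ B) (hx : x ∈ B) (hy : y ∈ B) (hxy : x ≠ y)
    (hdiag : δ ≤ ‖H x x - E‖) : ‖greenExt H B E x y‖ ≤ ε * B.card * δ⁻¹ * δ⁻¹ := by
  have hrow := sum_mul_greenExt (hgap.isUnit_det hδ) hx hy
  rw [if_neg hxy, ← Finset.add_sum_erase B _ hx] at hrow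
  have hterm : ∀ v ∈ B.erase x, ‖(H - (E : ℂ) • (1 : Matrix (Lattice d) (Lattice d) ℂ)) x v *
      greenExt H B E v y‖ ≤ ε * δ⁻¹ := by
    intro v hv
    have hxv : x ≠ v := (Finset.ne_of_mem_erase hv).symm
    rw [norm_mul]
    refine mul_le_mul ?_ (hgap.norm_greenExt_le hδ v y) (norm_nonneg _) hε
    simpa [one_apply_ne hxv] using hoff x v hxv
  have hmul : δ * ‖greenExt H B E x y‖ ≤ ε * B.card * δ⁻¹ :=
    calc δ * ‖greenExt H B E x y‖ ≤ ‖H x x - E‖ * ‖greenExt H B E x y‖ := by gcongr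
      _ = ‖(H - (E : ℂ) • (1 : Matrix (Lattice d) (Lattice d) ℂ)) x x * greenExt H B E x y‖ := by
          rw [norm_mul]
          simp
      _ ≤ (B.erase x).card • (ε * δ⁻¹) := by
          rw [eq_neg_of_add_eq_zero_left hrow, norm_neg]
          exact (norm_sum_le _ _).trans (Finset.sum_le_card_nsmul _ _ _ hterm)
      _ ≤ B.card • (ε * δ⁻¹) :=
          nsmul_le_nsmul_left (by positivity) (Finset.card_le_card (Finset.erase_subset _ _))
      _ = ε * B.card * δ⁻¹ := by rw [nsmul_eq_mul]; ring
  rwa [← div_eq_mul_inv, le_div_iff₀' hδ]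

theorem good_of_large_diagonal (hH : H.IsHermitian) (hoff : ∀ u v, u ≠ v → ‖H u v‖ ≤ ε)
    (hε : 0 ≤ ε) (hκ : 0 ≤ κ) (hρ : 0 ≤ ρ) (hL : 1 ≤ L)
    (hεL : ε * (3 * L) ^ d ≤ gapThreshold ρ' L ^ 2 * logDecay κ ρ (L + 1))
    (hdiag : ∀ u ∈ cube x L, 2 * gapThreshold ρ' L ≤ ‖H u u - E‖) : Good H ρ ρ' κ E x L := by
  set δ := gapThreshold ρ' L
  have hL0 : 0 ≤ L := by linarith
  have hδ : 0 < δ := gapThreshold_pos ρ' L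
  have hcard : ε * (cube x L).card ≤ δ ^ 2 * logDecay κ ρ (L + 1) :=
    (mul_le_mul_of_nonneg_left (card_cube_le x hL) hε).trans hεL
  have hδ2 : δ ^ 2 * logDecay κ ρ (L + 1) ≤ δ :=
    calc δ ^ 2 * logDecay κ ρ (L + 1) ≤ δ ^ 2 * 1 := by
          gcongr
          exact logDecay_le_one hκ (by linarith)
      _ = δ * δ := by ring
      _ ≤ δ := mul_le_of_le_one_right hδ.le (gapThreshold_le_one hL ρ')
  have hgap : HasGap H E δ (cube x L) :=
    hasGap_of_large_diagonal hH hoff hε hδ.le (hcard.trans hδ2) hdiag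
  refine ⟨(nonResonant_iff_hasGap hH hL0).2 hgap, fun hx y hy hxy => ?_⟩
  have hne : x ≠ y := by
    rintro rfl
    rw [sub_self, norm_zero] at hxy
    exact hxy.not_ge (Real.rpow_nonneg hL0 _)
  calc ‖green H (cube x L) E ⟨x, hx⟩ ⟨y, hy⟩‖ = ‖greenExt H (cube x L) E x y‖ := by
        rw [greenExt_of_mem hx hy]
    _ ≤ ε * (cube x L).card * δ⁻¹ * δ⁻¹ :=
        norm_greenExt_le_of_large_diagonal hoff hε hδ hgap hx hy hne (by linarith [hdiag x hx])
    _ ≤ δ ^ 2 * logDecay κ ρ (L + 1) * δ⁻¹ * δ⁻¹ := by gcongr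
    _ = logDecay κ ρ (L + 1) := by field_simp
    _ ≤ logDecay κ ρ (‖x - y‖ + 1) := by
        have hle : ‖x - y‖ ≤ L := by rw [norm_sub_rev]; exact mem_cube.1 hy
        have h0 := norm_nonneg (x - y)
        exact logDecay_antitoneOn hκ hρ (Set.mem_Ici.2 (by linarith))
          (Set.mem_Ici.2 (by linarith)) (by linarith)

end LargeDiagonal

theorem good_hamiltonian_of_large_potential {d : ℕ} {φ : Lattice d → ℂ}
    (hsym : ∀ x, φ x = starRingEnd ℂ (φ (-x))) (hφ : ∀ x, ‖φ x‖ ≤ 1) {ε E κ ρ ρ' L : ℝ}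
    (hε : 0 ≤ ε) (hκ : 0 ≤ κ) (hρ : 0 ≤ ρ) (hL : 1 ≤ L)
    (hεL : ε * (3 * L) ^ d ≤ gapThreshold ρ' L ^ 2 * logDecay κ ρ (L + 1))
    (hεδ : ε ≤ gapThreshold ρ' L) {v : Lattice d → ℝ} {x : Lattice d}
    (hv : ∀ z ∈ cube x L, 3 * gapThreshold ρ' L ≤ |v z - E|) :
    Good (hamiltonian ε φ v) ρ ρ' κ E x L := by
  have hhop : ∀ z, ‖(ε : ℂ) * φ z‖ ≤ ε := fun z => by
    rw [norm_mul, Complex.norm_real, Real.norm_eq_abs, abs_of_nonneg hε]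
    exact mul_le_of_le_one_right hε (hφ z)
  refine good_of_large_diagonal (isHermitian_hamiltonian hsym ε v) (fun u w huw => ?_) hε hκ hρ hL
    hεL fun u hu => ?_
  · simpa [hamiltonian, huw] using hhop (u - w)
  · have hsplit : hamiltonian ε φ v u u - E = ((v u - E : ℝ) : ℂ) + ε * φ (u - u) := by
      simp only [hamiltonian, of_apply, if_true]
      push_cast
      ring
    have htri := norm_sub_le_norm_add ((v u - E : ℝ) : ℂ) (ε * φ (u - u))
    rw [Complex.norm_real, Real.norm_eq_abs] at htri
    rw [hsplit]
    linarith [hv u hu, hhop (u - u)]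

theorem potentialLaw_badPair_initial_le {d : ℕ} {φ : Lattice d → ℂ}
    (hsym : ∀ x, φ x = starRingEnd ℂ (φ (-x))) (hφ : ∀ x, ‖φ x‖ ≤ 1) {μ : Measure ℝ}
    [IsProbabilityMeasure μ] {ε κ ρ ρ' η r L : ℝ} {s : ℝ≥0∞} (hε : 0 ≤ ε) (hκ : 0 ≤ κ)
    (hρ : 0 ≤ ρ) (hL : 1 ≤ L)
    (hεL : ε * (3 * L) ^ d ≤ gapThreshold ρ' L ^ 2 * logDecay κ ρ (L + 1))
    (hεδ : ε ≤ gapThreshold ρ' L) (hη : η ≤ gapThreshold ρ' L) (hr : 8 * gapThreshold ρ' L ≤ r)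
    (hs : ∀ a, μ (Set.Icc a (a + r)) ≤ s) (E₀ : ℝ) (x y : Lattice d) :
    potentialLaw d μ (badPair ε φ ρ ρ' κ L (Set.Icc (E₀ - η) (E₀ + η)) x y) ≤
      ENNReal.ofReal ((3 * L) ^ d) * s := by
  set δ := gapThreshold ρ' L
  let J : Set ℝ := Set.Icc (E₀ - 4 * δ) (E₀ - 4 * δ + r)
  have hcover : badPair ε φ ρ ρ' κ L (Set.Icc (E₀ - η) (E₀ + η)) x y ⊆
      ⋃ z ∈ cube x L, Function.eval z ⁻¹' J := by
    rintro v ⟨E, ⟨hE, hE'⟩, hbad, -⟩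
    obtain ⟨z, hz, hvz⟩ : ∃ z ∈ cube x L, |v z - E| < 3 * δ := by
      contrapose! hbad
      exact not_not.2 (good_hamiltonian_of_large_potential hsym hφ hε hκ hρ hL hεL hεδ hbad)
    rw [abs_lt] at hvz
    exact Set.mem_biUnion (x := z) hz ⟨by linarith, by linarith⟩
  have hterm : ∀ z ∈ cube x L, potentialLaw d μ (Function.eval z ⁻¹' J) ≤ s := fun z _ => by
    rw [(measurePreserving_eval_infinitePi (fun _ => μ) z).measure_preimage
      measurableSet_Icc.nullMeasurableSet]
    exact hs _
  calc _ ≤ ∑ _z ∈ cube x L, s := (measure_mono hcover).trans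
        ((measure_biUnion_finset_le _ _).trans (Finset.sum_le_sum hterm))
    _ = (cube x L).card * s := by rw [Finset.sum_const, nsmul_eq_mul]
    _ ≤ ENNReal.ofReal ((3 * L) ^ d) * s := by
        gcongr
        exact natCast_card_le_ofReal hL subset_rfl

/-! ### Multiscale induction -/

theorem eventually_pow_mul_rpow_le (d k : ℕ) (C : ℝ) {b c : ℝ} (h : d * k + b < c) :
    ∀ᶠ L : ℝ in atTop, ((3 * L) ^ d) ^ k * (C * L ^ b) ≤ L ^ c := by
  filter_upwards [eventually_mul_rpow_le_mul_rpow h (3 ^ (d * k) * C) one_pos,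
    eventually_gt_atTop 0] with L hL hL0
  calc ((3 * L) ^ d) ^ k * (C * L ^ b) = 3 ^ (d * k) * C * L ^ (d * k + b) := by
        rw [← pow_mul, mul_pow, Real.rpow_add hL0, ← Nat.cast_mul, Real.rpow_natCast]
        ring
    _ ≤ L ^ c := hL.trans_eq (one_mul _)

theorem eventually_mul_log_rpow_le (C r : ℝ) {c : ℝ} (hc : 0 < c) :
    ∀ᶠ L : ℝ in atTop, C * (Real.log L) ^ r ≤ c * L := by
  have h := ((isLittleO_log_rpow_rpow_atTop r one_pos).const_mul_left C).bound hc
  filter_upwards [h, eventually_gt_atTop 0] with L hL hL0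
  rw [Real.rpow_one, Real.norm_eq_abs, Real.norm_of_nonneg hL0.le] at hL
  exact (le_abs_self _).trans hL

theorem eventually_exp_neg_mul_le (d : ℕ) (κ ρ ρ' : ℝ) :
    ∀ᶠ L : ℝ in atTop, Real.exp (-L) * (3 * L) ^ d ≤
      gapThreshold ρ' L ^ 2 * logDecay κ ρ (L + 1) := by
  have hmul : Tendsto (fun L : ℝ => 3 * L) atTop atTop :=
    tendsto_id.const_mul_atTop zero_lt_three
  have hadd : Tendsto (fun L : ℝ => L + 1) atTop atTop :=
    tendsto_atTop_add_const_right _ 1 tendsto_id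
  filter_upwards [hmul.eventually (eventually_mul_log_rpow_le d 1 (c := 1 / 12) (by norm_num)),
    eventually_mul_log_rpow_le 2 ρ' (c := 1 / 4) (by norm_num),
    hadd.eventually (eventually_mul_log_rpow_le κ ρ (c := 1 / 8) (by norm_num)),
    eventually_ge_atTop 1] with L hpow hgap hdecay hL
  have hcard : (3 * L) ^ d = Real.exp (d * Real.log (3 * L)) := by
    rw [mul_comm (d : ℝ), Real.exp_mul, Real.exp_log (by linarith), Real.rpow_natCast]
  rw [Real.rpow_one] at hpow
  rw [hcard, gapThreshold, logDecay, ← Real.exp_nat_mul, ← Real.exp_add, ← Real.exp_add,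
    Real.exp_le_exp]
  push_cast
  linarith

section Induction

variable {d : ℕ} {φ : Lattice d → ℂ} {μ : Measure ℝ} {C t a α ε κ κ' lam p ρ ρ' σ L : ℝ}
  {I : Set ℝ}

theorem eventually_measure_Icc_le (hlam : 0 < lam) (ht : 0 < t)
    (hμ : ∀ a r : ℝ, 0 < r → r ≤ t → μ (Set.Icc a (a + r)) ≤ ENNReal.ofReal (C * r ^ lam))
    (hρ' : 1 < ρ') (d : ℕ) (c q : ℝ) :
    ∀ᶠ L : ℝ in atTop, ∀ a, μ (Set.Icc a (a + c * gapThreshold ρ' L * (3 * L) ^ d)) ≤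
      ENNReal.ofReal (L ^ (-q)) := by
  let q' : ℝ := (|q| + 1) / lam
  have hq' : 0 < q' := by positivity
  have hqq' : -q' * lam < -q := by
    rw [neg_mul, div_mul_cancel₀ _ hlam.ne']
    linarith [le_abs_self q]
  filter_upwards [eventually_mul_rpow_le_exp_mul_log_rpow (c * 3 ^ d) (d + q') one_pos hρ',
    eventually_mul_rpow_le_mul_rpow (neg_lt_zero.2 hq') 1 ht,
    eventually_mul_rpow_le_mul_rpow hqq' C one_pos, eventually_gt_atTop 0] with L hr hrt hC hL
  have hr : c * gapThreshold ρ' L * (3 * L) ^ d ≤ L ^ (-q') := by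
    rw [Real.rpow_neg hL.le, ← one_div, le_div_iff₀ (Real.rpow_pos_of_pos hL _), gapThreshold,
      Real.exp_neg]
    rw [Real.rpow_add hL, Real.rpow_natCast, one_mul] at hr
    calc _ = c * 3 ^ d * (L ^ d * L ^ q') / Real.exp ((Real.log L) ^ ρ') := by
          rw [mul_pow]; ring
      _ ≤ 1 := (div_le_one (Real.exp_pos _)).2 hr
  intro a
  calc μ (Set.Icc a (a + c * gapThreshold ρ' L * (3 * L) ^ d))
      ≤ μ (Set.Icc a (a + L ^ (-q'))) := by gcongr
    _ ≤ ENNReal.ofReal (C * (L ^ (-q')) ^ lam) :=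
        hμ _ _ (Real.rpow_pos_of_pos hL _) (by simpa using hrt)
    _ ≤ ENNReal.ofReal (L ^ (-q)) := by
        rw [← Real.rpow_mul hL.le]
        exact ENNReal.ofReal_le_ofReal (by simpa using hC)

/-- The conclusion of the multiscale analysis at the scale `L`: two disjoint cubes are both bad at
a common energy with probability at most `L ^ (-2 p)`. -/
def PairBound (μ : Measure ℝ) (ε : ℝ) (φ : Lattice d → ℂ) (ρ ρ' p : ℝ) (I : Set ℝ) (κ L : ℝ) :
    Prop :=
  ∀ x y, 2 * L < ‖x - y‖ →
    potentialLaw d μ (badPair ε φ ρ ρ' κ L I x y) ≤ ENNReal.ofReal (L ^ (-(2 * p)))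

theorem PairBound.mono (h : PairBound μ ε φ ρ ρ' p I κ' L) (hκ : κ ≤ κ') :
    PairBound μ ε φ ρ ρ' p I κ L :=
  fun x y hxy => (measure_mono (badPair_mono hκ)).trans (h x y hxy)

theorem PairBound.measure_le (h : PairBound μ ε φ ρ ρ' p I κ L)
    (hsym : ∀ x, φ x = starRingEnd ℂ (φ (-x))) (hL : 0 ≤ L) {Ω : Type*} [MeasurableSpace Ω]
    {P : Measure Ω} {V : Lattice d → Ω → ℝ} (hV : ∀ x, Measurable (V x))
    (hlaw : ∀ x, P.map (V x) = μ) (hind : iIndepFun V P) {x y : Lattice d}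
    (hxy : 2 * L < ‖x - y‖) :
    P {ω | (fun z => V z ω) ∈ badPair ε φ ρ ρ' κ L I x y} ≤ ENNReal.ofReal (L ^ (-(2 * p))) := by
  have hmap : P.map (fun ω z => V z ω) = potentialLaw d μ := by
    rw [hind.map_fun_eq_infinitePi_map hV]
    simp only [hlaw]
  change P ((fun ω z => V z ω) ⁻¹' badPair ε φ ρ ρ' κ L I x y) ≤ _
  rw [← Measure.map_apply (measurable_pi_lambda _ hV)
    (isOpen_badPair hsym ε ρ ρ' κ hL I x y).measurableSet, hmap]
  exact h x y hxy

variable [IsProbabilityMeasure μ]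

theorem eventually_pairBound_initial (hsym : ∀ x, φ x = starRingEnd ℂ (φ (-x)))
    (hφ : ∀ x, ‖φ x‖ ≤ 1) (hlam : 0 < lam) (ht : 0 < t)
    (hμ : ∀ a r : ℝ, 0 < r → r ≤ t → μ (Set.Icc a (a + r)) ≤ ENNReal.ofReal (C * r ^ lam))
    (hκ : 0 ≤ κ) (hρ : 0 ≤ ρ) (hρ' : 1 < ρ') (p : ℝ) :
    ∀ᶠ L : ℝ in atTop, ∀ E₀ ε : ℝ, 0 ≤ ε → ε ≤ Real.exp (-L) →
      PairBound μ ε φ ρ ρ' p (Set.Icc (E₀ - Real.exp (-L)) (E₀ + Real.exp (-L))) κ L := by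
  filter_upwards [eventually_measure_Icc_le hlam ht hμ hρ' d 8 (d + 2 * p + 1),
    eventually_exp_neg_mul_le d κ ρ ρ', eventually_ge_atTop 1,
    eventually_pow_mul_rpow_le d 1 1 (b := -(d + 2 * p + 1)) (c := -(2 * p))
      (by push_cast; linarith)] with L hμL hexp hL hpow
  intro E₀ ε hε hεL x y _
  have hδ := gapThreshold_pos ρ' L
  have hcard : 1 ≤ (3 * L) ^ d := one_le_pow₀ (by linarith)
  have hexpδ : Real.exp (-L) ≤ gapThreshold ρ' L :=
    calc Real.exp (-L) ≤ Real.exp (-L) * (3 * L) ^ d :=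
          le_mul_of_one_le_right (Real.exp_pos _).le hcard
      _ ≤ gapThreshold ρ' L ^ 2 * logDecay κ ρ (L + 1) := hexp
      _ ≤ gapThreshold ρ' L * 1 := by
          rw [sq, mul_assoc]
          gcongr
          exact mul_le_one₀ (gapThreshold_le_one hL ρ') (logDecay_pos ..).le
            (logDecay_le_one hκ (by linarith))
      _ = gapThreshold ρ' L := mul_one _
  calc _ ≤ ENNReal.ofReal ((3 * L) ^ d) * ENNReal.ofReal (L ^ (-(d + 2 * p + 1))) :=
        potentialLaw_badPair_initial_le hsym hφ hε hκ hρ hL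
          ((mul_le_mul_of_nonneg_right hεL (by positivity)).trans hexp) (hεL.trans hexpδ) hexpδ
          (le_mul_of_one_le_right (by positivity) hcard) hμL E₀ x y
    _ ≤ ENNReal.ofReal (L ^ (-(2 * p))) := by
        rw [← ENNReal.ofReal_mul (by positivity)]
        exact ENNReal.ofReal_le_ofReal (by simpa using hpow)

theorem tendsto_floor_rpow (hα : 0 < α) :
    Tendsto (fun l : ℝ => ((⌊l ^ α⌋ : ℤ) : ℝ)) atTop atTop :=
  (tendsto_intCast_atTop_atTop.comp tendsto_floor_atTop).comp (tendsto_rpow_atTop hα)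

theorem eventually_rpow_le_floor_rpow (ha : 0 ≤ a) (haα : a < α) :
    ∀ᶠ l : ℝ in atTop, l ^ a ≤ (⌊l ^ α⌋ : ℤ) := by
  filter_upwards [eventually_mul_rpow_le_mul_rpow haα 2 one_pos, eventually_ge_atTop 1]
    with l hl hl1
  linarith [Int.sub_one_lt_floor (l ^ α), Real.one_le_rpow hl1 ha]

/-- Since `q * q ≤ L ^ (-4 p / α)` for `L ≤ l ^ α`, the step closes when
`4 d - 4 p / α < - 2 p`. -/
theorem eventually_pairBound_step (hsym : ∀ x, φ x = starRingEnd ℂ (φ (-x)))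
    (hφ : ∀ x, ‖φ x‖ ≤ logDecay κ ρ (‖x‖ + 1)) (hlam : 0 < lam) (ht : 0 < t)
    (hμ : ∀ a r : ℝ, 0 < r → r ≤ t → μ (Set.Icc a (a + r)) ≤ ENNReal.ofReal (C * r ^ lam))
    (hρ' : 1 < ρ') (hρ'ρ : ρ' < ρ) {κinf : ℝ} (hκinf : 0 < κinf) (hκ : κinf < κ) (hσ0 : 0 < σ)
    (hσ1 : σ < 1) (hσρ : σ < ρ - ρ') (hα1 : 5 / 4 < α) (hα2 : α ≤ 2) (hp : 0 ≤ p)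
    (hpα : d * 4 + -(4 * p / α) < -(2 * p)) :
    ∀ᶠ l : ℝ in atTop, ∀ ε I, 0 ≤ ε → ε ≤ 1 →
      PairBound μ ε φ ρ ρ' p I (rate κ κinf σ l) l →
      PairBound μ ε φ ρ ρ' p I (rate κ κinf σ (⌊l ^ α⌋ : ℤ)) (⌊l ^ α⌋ : ℤ) := by
  have hα0 : 0 < α := by linarith
  obtain ⟨a, ha, haα⟩ := exists_between hα1
  filter_upwards [eventually_good_of_not_resonant d hρ' hρ'ρ hκinf hκ hσ0 hσ1 hσρ ha,
    eventually_rpow_le_floor_rpow (by linarith) haα, eventually_ge_atTop 1,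
    (tendsto_floor_rpow hα0).eventually (eventually_ge_atTop 1),
    (tendsto_floor_rpow hα0).eventually
      (eventually_measure_Icc_le hlam ht hμ hρ' d 4 (4 * p / α)),
    (tendsto_floor_rpow hα0).eventually (eventually_pow_mul_rpow_le d 4 27
      (b := -(4 * p / α)) (c := -(2 * p)) (by exact_mod_cast hpα))]
    with l hgood hal hl hL hμL hpow ε I hε hε1 hpair x y hxy
  have hLα := Int.floor_le (l ^ α)
  set L : ℝ := ((⌊l ^ α⌋ : ℤ) : ℝ)
  have hl0 : 0 < l := by linarith
  have hL2 : L ≤ l ^ (2 : ℝ) := hLα.trans (Real.rpow_le_rpow_of_exponent_le hl hα2)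
  have hsq : ENNReal.ofReal (l ^ (-(2 * p))) * ENNReal.ofReal (l ^ (-(2 * p))) ≤
      ENNReal.ofReal (L ^ (-(4 * p / α))) := by
    rw [← ENNReal.ofReal_mul (by positivity)]
    refine ENNReal.ofReal_le_ofReal ?_
    calc l ^ (-(2 * p)) * l ^ (-(2 * p)) = (l ^ α) ^ (-(4 * p / α)) := by
          rw [← Real.rpow_add hl0, ← Real.rpow_mul hl0.le]
          congr 1
          field_simp
          ring
      _ ≤ L ^ (-(4 * p / α)) :=
          Real.rpow_le_rpow_of_nonpos (by linarith) hLα (neg_nonpos.2 (by positivity))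
  calc _ ≤ ENNReal.ofReal ((3 * L) ^ d) ^ 4 * (25 * ENNReal.ofReal (L ^ (-(4 * p / α))) +
          2 * (ENNReal.ofReal (l ^ (-(2 * p))) * ENNReal.ofReal (l ^ (-(2 * p))))) :=
        potentialLaw_badPair_step_le hsym (gapThreshold_pos ρ' L) hl0.le hL
          (fun E v x => hgood L hal hL2 _ E x (isHermitian_hamiltonian hsym ε v)
            (offDiagDecay_hamiltonian hφ hε hε1 v)) hμL hpair hxy
    _ ≤ ENNReal.ofReal ((3 * L) ^ d) ^ 4 * (25 * ENNReal.ofReal (L ^ (-(4 * p / α))) +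
          2 * ENNReal.ofReal (L ^ (-(4 * p / α)))) := by gcongr
    _ = ENNReal.ofReal (((3 * L) ^ d) ^ 4 * (27 * L ^ (-(4 * p / α)))) := by
        have h27 : (25 : ℝ≥0∞) + 2 = ENNReal.ofReal 27 := by norm_num
        rw [← add_mul, h27, ← ENNReal.ofReal_pow (by positivity),
          ← ENNReal.ofReal_mul (by norm_num), ← ENNReal.ofReal_mul (by positivity)]
    _ ≤ ENNReal.ofReal (L ^ (-(2 * p))) := ENNReal.ofReal_le_ofReal hpow

theorem eventually_forall_scale (hα : 1 < α) {Q : ℝ → Prop} (hQ : ∀ᶠ l in atTop, Q l) :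
    ∀ᶠ L₀ in atTop, ∀ s, Q (scale α L₀ s) := by
  obtain ⟨l₀, hl₀⟩ := eventually_atTop.1
    (hQ.and (eventually_rpow_le_floor_rpow zero_le_one hα))
  filter_upwards [eventually_ge_atTop l₀] with L₀ hL₀
  have hscale : ∀ s, l₀ ≤ scale α L₀ s := fun s => by
    induction s with
    | zero => exact hL₀
    | succ s ih => exact ih.trans ((Real.rpow_one _).symm.trans_le (hl₀ _ ih).2)
  exact fun s => (hl₀ _ (hscale s)).1

theorem eventually_forall_pairBound_scale (hsym : ∀ x, φ x = starRingEnd ℂ (φ (-x)))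
    (hφ : ∀ x, ‖φ x‖ ≤ logDecay κ ρ (‖x‖ + 1)) (hlam : 0 < lam) (hμ : IsHolder lam μ)
    (hρ' : 1 < ρ') (hρ'ρ : ρ' < ρ) {κinf : ℝ} (hκinf : 0 < κinf) (hκ : κinf < κ) (hp : 0 < p)
    (hα1 : 5 / 4 < α) (hα2 : α < 2 * p / (p + 2 * d)) :
    ∀ᶠ L₀ : ℝ in atTop, ∀ E₀ ε : ℝ, 0 ≤ ε → ε ≤ Real.exp (-L₀) → ∀ s, PairBound μ ε φ ρ ρ' p
      (Set.Icc (E₀ - Real.exp (-L₀)) (E₀ + Real.exp (-L₀))) κinf (scale α L₀ s) := by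
  obtain ⟨C, t, ht, hIcc⟩ := hμ.exists_measure_Icc_le
  have hκ0 : 0 ≤ κ := (hκinf.trans hκ).le
  have hρ0 : 0 ≤ ρ := by linarith
  have hφ1 : ∀ x, ‖φ x‖ ≤ 1 := fun x =>
    (hφ x).trans (logDecay_le_one hκ0 (by linarith [norm_nonneg x]))
  obtain ⟨σ, hσ0, hσ⟩ := exists_between (lt_min one_pos (sub_pos.2 hρ'ρ))
  obtain ⟨hσ1, hσρ⟩ := lt_min_iff.1 hσ
  have hα0 : 0 < α := by linarith
  have hpα : α * (p + 2 * d) < 2 * p := (lt_div_iff₀ (by positivity)).1 hα2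
  have hα_le : α ≤ 2 := by
    by_contra! h
    nlinarith [mul_nonneg hα0.le (Nat.cast_nonneg (α := ℝ) d)]
  have hexponent : d * 4 + -(4 * p / α) < -(2 * p) := by
    have : 2 * p + d * 4 < 4 * p / α := (lt_div_iff₀ hα0).2 (by linarith)
    linarith
  filter_upwards [eventually_pairBound_initial hsym hφ1 hlam ht hIcc hκ0 hρ0 hρ' p,
    eventually_forall_scale (α := α) (by linarith) (eventually_pairBound_step hsym hφ hlam ht hIcc
      hρ' hρ'ρ hκinf hκ hσ0 hσ1 hσρ hα1 hα_le hp.le hexponent),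
    eventually_forall_scale (α := α) (by linarith) (eventually_ge_atTop 1),
    Real.tendsto_log_atTop.eventually (eventually_ge_atTop 1), eventually_ge_atTop 0]
    with L₀ hinit hstep hscale hlog hL₀ E₀ ε hε hεL s
  have hε1 : ε ≤ 1 := hεL.trans (Real.exp_le_one_iff.2 (by linarith))
  suffices hrate : PairBound μ ε φ ρ ρ' p (Set.Icc (E₀ - Real.exp (-L₀)) (E₀ + Real.exp (-L₀)))
      (rate κ κinf σ (scale α L₀ s)) (scale α L₀ s) from hrate.mono (le_rate hκ.le (hscale s))
  induction s with
  | zero => exact (hinit E₀ ε hε hεL).mono (rate_le hκ.le hσ0.le hlog)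
  | succ s ih => exact hstep s ε _ hε hε1 ih

end Induction

end LongRangeMSA

theorem theorem5p4_general (d : ℕ) {lam : ℝ} (hlam : 0 < lam) {μ : Measure ℝ}
    [IsProbabilityMeasure μ] (hμ : IsHolder lam μ) {φ : Lattice d → ℂ}
    (hsym : ∀ x, φ x = starRingEnd ℂ (φ (-x))) {γ ρ ρ' κinf p α : ℝ}
    (hφ : ∀ x, ‖φ x‖ ≤ Real.exp (-γ * (Real.log (‖x‖ + 1)) ^ ρ)) (hρ' : 1 < ρ') (hρ'ρ : ρ' < ρ)
    (hκinf : 0 < κinf) (hκγ : κinf < γ) (hp : 0 < p) (hα1 : 5 / 4 < α)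
    (hα2 : α < 2 * p / (p + 2 * d)) :
    ∃ Lmin : ℝ, 0 < Lmin ∧ ∀ L₀ : ℝ, Lmin ≤ L₀ → ∀ E₀ ε : ℝ, 0 ≤ ε → ε ≤ Real.exp (-L₀) →
    ∀ (Ω : Type*) [MeasurableSpace Ω] (P : Measure Ω) (V : Lattice d → Ω → ℝ),
    (∀ x, Measurable (V x)) → (∀ x, P.map (V x) = μ) → iIndepFun V P →
    ∀ (s : ℕ) (x y : Lattice d), 2 * scale α L₀ s < ‖x - y‖ →
      P {ω | ∃ E ∈ Set.Icc (E₀ - Real.exp (-L₀)) (E₀ + Real.exp (-L₀)),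
          Bad (hamiltonian ε φ fun z => V z ω) ρ ρ' κinf E x (scale α L₀ s) ∧
          Bad (hamiltonian ε φ fun z => V z ω) ρ ρ' κinf E y (scale α L₀ s)} ≤
        ENNReal.ofReal (scale α L₀ s ^ (-(2 * p))) := by
  obtain ⟨Lmin, hLmin⟩ := Filter.eventually_atTop.1
    ((eventually_forall_pairBound_scale hsym hφ hlam hμ hρ' hρ'ρ hκinf hκγ hp hα1 hα2).and
      (eventually_forall_scale (α := α) (by linarith) (Filter.eventually_ge_atTop 0)))
  refine ⟨max Lmin 1, by positivity, fun L₀ hL₀ E₀ ε hε hεL Ω _ P V hV hlaw hind s x y hxy => ?_⟩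
  obtain ⟨hpair, hscale⟩ := hLmin L₀ ((le_max_left _ _).trans hL₀)
  exact (hpair E₀ ε hε hεL s).measure_le hsym (hscale s) hV hlaw hind hxy

theorem theorem5p4 (d : ℕ) (lam β : ℝ) (hlam : 0 < lam) (hβ : 0 < β) :
    -- `η` depends only on `d`, `lam`, `β` and `L₀`
    ∃ η : ℝ → ℝ, (∀ L₀, 0 < η L₀) ∧
    ∀ (μ : Measure ℝ) [IsProbabilityMeasure μ], IsHolder lam μ →
    ENNReal.ofReal β < holderD lam μ →
    ∀ φ : Lattice d → ℂ, (∀ x, φ x = starRingEnd ℂ (φ (-x))) →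
    -- `ε₀` depends only on `d`, `lam`, `β`, `μ`, `φ` and `L₀`
    ∃ ε₀ : ℝ → ℝ, (∀ L₀, 0 < ε₀ L₀) ∧
    ∀ M γ ρ ρ' κ₀ κinf p α : ℝ,
    0 < M → μ.support ⊆ Set.Icc (-M) M →
    0 < γ → 1 < ρ → (∀ x, ‖φ x‖ ≤ Real.exp (-γ * (Real.log (‖x‖ + 1)) ^ ρ)) →
    1 < ρ' → ρ' < ρ →
    0 < κ₀ → κ₀ ≤ γ / 5 → 0 < κinf → κinf < κ₀ →
    5 * (d : ℝ) < p → 5 / 4 < α → α < 2 * p / (p + 2 * d) →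
    -- the lower bound for `L₀` depends on all of the above, but not on `E₀`, `ε` or `V`
    ∃ Lmin : ℝ, 0 < Lmin ∧ ∀ L₀ : ℝ, Lmin ≤ L₀ →
    ∀ E₀ : ℝ, |E₀| ≤ 2 * (‖hoppingOp φ‖ + M) →
    ∀ ε : ℝ, 0 < ε → ε < ε₀ L₀ →
    ∀ (Ω : Type*) [MeasurableSpace Ω] (P : Measure Ω) [IsProbabilityMeasure P]
      (V : Lattice d → Ω → ℝ),
    (∀ x, Measurable (V x)) → (∀ x, P.map (V x) = μ) → iIndepFun V P →
    ∀ (s : ℕ) (x y : Lattice d), 2 * scale α L₀ s < ‖x - y‖ →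
      P {ω | ∃ E ∈ Set.Icc (E₀ - η L₀) (E₀ + η L₀),
          Bad (hamiltonian ε φ fun z => V z ω) ρ ρ' κinf E x (scale α L₀ s) ∧
          Bad (hamiltonian ε φ fun z => V z ω) ρ ρ' κinf E y (scale α L₀ s)} ≤
        ENNReal.ofReal (scale α L₀ s ^ (-(2 * p))) := by
  refine ⟨fun L₀ => Real.exp (-L₀), fun _ => Real.exp_pos _, ?_⟩
  intro μ _ hμ _ φ hsym
  refine ⟨fun L₀ => Real.exp (-L₀), fun _ => Real.exp_pos _, ?_⟩
  intro M γ ρ ρ' κ₀ κinf p α _ _ _ _ hφ hρ' hρ'ρ _ hκ₀ hκinf hκ hp hα1 hα2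
  obtain ⟨Lmin, hLmin, h⟩ := theorem5p4_general d hlam hμ hsym hφ hρ' hρ'ρ hκinf (by linarith)
    (lt_of_le_of_lt (by positivity) hp) hα1 hα2
  exact ⟨Lmin, hLmin, fun L₀ hL₀ E₀ _ ε hε hεL Ω _ P _ => h L₀ hL₀ E₀ ε hε.le hεL.le Ω P⟩
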